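/- Let $k$ be an algebraically closed field and let $\mathcal{E}$ be a $k$-linear, Hom-finite, Krull–Schmidt Frobenius category (a Quillen exact category with enough projectives and enough injectives in which projectives and injectives coincide). Let $\mathcal{C}$ be its stable category, i.e. the quotient of $\mathcal{E}$ by the ideal of morphisms factoring through a projective-injective object. Its suspension $\Sigma$ is given by fixed conflations $M\to IM\to\Sigma M$ with $IM$ injective. Its triangles are the sequences $M\to Y\to L\to\Sigma M$ isomorphic in $\mathcal{C}$ to those induced by conflations $A\to B\to C$ of $\mathcal{E}$ together with a morphism $e:C\to\Sigma A$ along which $A\to B\to C$ is the pull-back of $A\to IA\to\Sigma A$. For an object $T$ of $\mathcal{C}$ put $B=\mathrm{End}_{\mathcal{C}}(T)$ and $F=\mathcal{C}(T,-)$, a functor from $\mathcal{C}$ to finite-dimensional right $B$-modules. Let $\vec{A}_4$ be the quiver $1\to2\to3\to4$. For $d=(d_1,d_2,d_3,d_4)\in\mathbb{N}^4$ let $\mathrm{rep}_d(B\vec{A}_4)$ be the affine variety of right $B$-module structures on $k^{d_1},\dots,k^{d_4}$ together with $B$-linear maps $k^{d_1}\to k^{d_2}\to k^{d_3}\to k^{d_4}$,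 with the action of $GL(d)=\prod_i GL_{d_i}(k)$ by change of bases. A map $X\to Y$ of varieties is constructible if $X$ is a finite disjoint union of locally closed subsets on each of which the map restricts to a morphism of varieties. Let $T,L,M$ be objects of $\mathcal{C}$. (1) If $M\xrightarrow{i}Y\xrightarrow{p}L\xrightarrow{\varepsilon}\Sigma M$ is a triangle in $\mathcal{C}$, then the sequence of $B$-modules $FM\xrightarrow{Fi}FY\xrightarrow{Fp}FL\xrightarrow{F\varepsilon}F\Sigma M$ is exact. (2) Every $\varepsilon\in\mathcal{C}(L,\Sigma M)$ is the third morphism of such a triangle. Let $D$ be the set of all $d\in\mathbb{N}^4$ with $d_1=\dim FM$, $d_2\le d_1+d_3$, $d_3=\dim FL$ and $d_4=\dim F\Sigma M$. There is a constructible map $$\varphi:\ \mathcal{C}(L,\Sigma M)\longrightarrow\coprod_{d\in D}\mathrm{rep}_d(B\vec{A}_4)$$ such that for every $\varepsilon\in\mathcal{C}(L,\Sigma M)$ and every triangle $M\xrightarrow{i}Y\xrightarrow{p}L\xrightarrow{\varepsilon}\Sigma M$, the point $\varphi(\varepsilon)$ lies in the $GL(d)$-orbit of matrix representations given by $FM\xrightarrow{Fi}FY\xrightarrow{Fp}FL\xrightarrow{F\varepsilon}F\Sigma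 M$. (3) In particular, $\mathcal{C}$ has constructible cones: for all objects $T,L,M$ of $\mathcal{C}$, the map sending $\varepsilon\in\mathcal{C}(L,\Sigma M)$ to the orbit of $FM\to FY\to FL\to F\Sigma M$ lifts to a constructible map $\mathcal{C}(L,\Sigma M)\to\coprod_{d\le d_{\max}}\mathrm{rep}_d(B\vec{A}_4)$, where $d_{\max}=(\dim FM,\ \dim FM+\dim FL,\ \dim FL,\ \dim F\Sigma M)$ and $d\le d_{\max}$ is meant componentwise. -/

import Mathlib

open CategoryTheory CategoryTheory.Limits

universe v u

noncomputable section

/-! ## Classical algebraic geometry over an algebraically closed field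

An affine variety is handled through its set of points `X` and its coordinate ring, given as a
`k`-subalgebra `A` of the algebra of all functions `X → k`. -/

section Varieties

variable {k : Type*} [Field k]

/-- The Zariski topology on an affine variety with coordinate ring `A`: the basic open sets are
the non-vanishing loci of the elements of `A`. -/
@[reducible]
def zariskiTopology {X : Type*} (A : Subalgebra k (X → k)) : TopologicalSpace X :=
  TopologicalSpace.generateFrom {U | ∃ f ∈ A, U = {x | f x ≠ 0}}

/-- `f` is a regular function on the subset `S` of an affine variety with coordinate ring `A`:
locally on `S` (for the Zariski topology), `f` is a quotient of two elements of `A`. -/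
def IsRegularOn {X : Type*} (A : Subalgebra k (X → k)) (S : Set X) (f : X → k) : Prop :=
  ∀ x ∈ S, ∃ p ∈ A, ∃ q ∈ A, q x ≠ 0 ∧ ∀ y ∈ S, q y ≠ 0 → f y = p y / q y

/-- The restriction of `f` to the (locally closed) subset `S` is a morphism of varieties from `S`
to the affine variety `Y` with coordinate ring `A'`: it pulls back regular functions on `Y` to
regular functions on `S`. -/
def IsMorphismOn {X Y : Type*} (A : Subalgebra k (X → k)) (A' : Subalgebra k (Y → k))
    (S : Set X) (f : X → Y) : Prop :=
  ∀ g ∈ A', IsRegularOn A S (g ∘ f)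

/-- A map `f : X → Y` is constructible if `X` is a finite disjoint union of locally closed
subsets such that the restriction of `f` to each of them is a morphism of varieties. -/
def IsConstructibleMap {X Y : Type*} (A : Subalgebra k (X → k)) (A' : Subalgebra k (Y → k))
    (f : X → Y) : Prop :=
  ∃ (n : ℕ) (S : Fin n → Set X),
    (∀ i, @IsLocallyClosed X (zariskiTopology A) (S i)) ∧
    Pairwise (fun i j => Disjoint (S i) (S j)) ∧
    (⋃ i, S i) = Set.univ ∧
    ∀ i, IsMorphismOn A A' (S i) f

/-- The coordinate ring of a finite-dimensional vector space `V`, seen as an affine space: the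
algebra of polynomial functions, generated by the linear forms. -/
def affineSpaceRing (k : Type*) [Field k] (V : Type*) [AddCommGroup V] [Module k V] :
    Subalgebra k (V → k) :=
  Algebra.adjoin k (Set.range fun l : Module.Dual k V => (l : V → k))

/-- The coordinate ring of a (finite) disjoint union of affine varieties: a function is regular
if its restriction to each component is. -/
def sigmaRing {ι : Type*} {Y : ι → Type*} (A : ∀ i, Subalgebra k (Y i → k)) :
    Subalgebra k ((Σ i, Y i) → k) where
  carrier := {f | ∀ i, (fun y => f ⟨i, y⟩) ∈ A i}
  mul_mem' hf hg i := (A i).mul_mem (hf i) (hg i)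
  add_mem' hf hg i := (A i).add_mem (hf i) (hg i)
  algebraMap_mem' c i := (A i).algebraMap_mem c

end Varieties

/-! ## Matrix representations of quivers in categories of modules -/

section Representations

/-- The variety `rep_d BQ` of `d`-dimensional matrix representations of the quiver `Q` in the
category of right `B`-modules: a right `B`-module structure on `k ^ (d i)` for each vertex `i`,
and a `B`-linear map `k ^ (d i) → k ^ (d j)` for each arrow `i ⟶ j`. -/
structure MatRep (k : Type*) [Field k] (B : Type*) [Ring B] [Algebra k B]
    (Q : Type*) [Quiver Q] (d : Q → ℕ) where
  act : ∀ i, Bᵐᵒᵖ →ₐ[k] Matrix (Fin (d i)) (Fin (d i)) k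
  map : ∀ {i j : Q}, (i ⟶ j) → Matrix (Fin (d j)) (Fin (d i)) k
  map_act : ∀ {i j : Q} (a : i ⟶ j) (b : Bᵐᵒᵖ), map a * act i b = act j b * map a

/-- The coordinate ring of `rep_d BQ`, generated by the entries of all the matrices. -/
def MatRep.coordinateRing (k : Type*) [Field k] (B : Type*) [Ring B] [Algebra k B]
    (Q : Type*) [Quiver Q] (d : Q → ℕ) : Subalgebra k (MatRep k B Q d → k) :=
  Algebra.adjoin k
    ({f | ∃ (i : Q) (b : Bᵐᵒᵖ) (r s : Fin (d i)), f = fun R => R.act i b r s} ∪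
      {f | ∃ (i j : Q) (a : i ⟶ j) (r : Fin (d j)) (s : Fin (d i)), f = fun R => R.map a r s})

/-- The `GL(d)`-orbit in `rep_d BQ` of the representation `F D` of `Q` in the category of right
`B`-modules, where `B = End T`, where `F = Hom(T, -)`, with `B` acting by precomposition, and
where `D` is a representation of `Q` in the category `C`. It consists of the matrix representations
obtained from `F D` by choosing bases of the spaces `Hom(T, D i)`. -/
def homOrbit (k : Type*) [Field k] {C : Type*} [Category C] [Preadditive C] [Linear k C]
    {Q : Type*} [Quiver Q] (T : C) (D : Q ⥤q C) (d : Q → ℕ) : Set (MatRep k (End T) Q d) :=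
  {R | ∃ e : ∀ i, (T ⟶ D.obj i) ≃ₗ[k] (Fin (d i) → k),
    (∀ (i : Q) (b : End T) (x : T ⟶ D.obj i),
      e i ((show T ⟶ T from b) ≫ x) = (R.act i (MulOpposite.op b)).mulVec (e i x)) ∧
    ∀ (i j : Q) (a : i ⟶ j) (x : T ⟶ D.obj i),
      e j (x ≫ D.map a) = (R.map a).mulVec (e i x)}

/-- The vertices of the quiver `A₄ : 1 → 2 → 3 → 4`. -/
inductive QuiverA4 : Type
  | v1 | v2 | v3 | v4

/-- The arrows of the quiver `A₄ : 1 → 2 → 3 → 4`. -/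
inductive QuiverA4.Arrow : QuiverA4 → QuiverA4 → Type
  | a12 : QuiverA4.Arrow v1 v2
  | a23 : QuiverA4.Arrow v2 v3
  | a34 : QuiverA4.Arrow v3 v4

instance : Quiver QuiverA4 := ⟨QuiverA4.Arrow⟩

/-- The representation `X₁ → X₂ → X₃ → X₄` of `A₄` in a category. -/
def QuiverA4.diagram {C : Type*} [Category C] {X₁ X₂ X₃ X₄ : C}
    (f : X₁ ⟶ X₂) (g : X₂ ⟶ X₃) (h : X₃ ⟶ X₄) : QuiverA4 ⥤q C where
  obj
    | v1 => X₁
    | v2 => X₂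
    | v3 => X₃
    | v4 => X₄
  map {i j} a := match i, j, a with
    | _, _, QuiverA4.Arrow.a12 => f
    | _, _, QuiverA4.Arrow.a23 => g
    | _, _, QuiverA4.Arrow.a34 => h

/-- The dimension vector `(n₁, n₂, n₃, n₄)` of `A₄`. -/
def QuiverA4.dimVec (n₁ n₂ n₃ n₄ : ℕ) : QuiverA4 → ℕ
  | v1 => n₁
  | v2 => n₂
  | v3 => n₃
  | v4 => n₄

end Representations

/-! ## Krull–Schmidt, exact and Frobenius categories -/

/-- Every object is a finite direct sum of objects with local endomorphism rings. -/
def IsKrullSchmidt (E : Type u) [Category.{v} E] [Preadditive E] [HasFiniteBiproducts E] : Prop :=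
  ∀ X : E, ∃ (n : ℕ) (f : Fin n → E), (∀ i, IsLocalRing (End (f i))) ∧ Nonempty (X ≅ ⨁ f)

section Exact

variable {E : Type u} [Category.{v} E] [Preadditive E]

/-- `i` is the first morphism of a short complex satisfying `P`. -/
def IsInflationFor (P : ShortComplex E → Prop) {X Y : E} (i : X ⟶ Y) : Prop :=
  ∃ (Z : E) (p : Y ⟶ Z) (w : i ≫ p = 0), P (ShortComplex.mk i p w)

/-- `p` is the second morphism of a short complex satisfying `P`. -/
def IsDeflationFor (P : ShortComplex E → Prop) {Y Z : E} (p : Y ⟶ Z) : Prop :=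
  ∃ (X : E) (i : X ⟶ Y) (w : i ≫ p = 0), P (ShortComplex.mk i p w)

end Exact

/-- An exact structure, in the sense of Quillen, on an additive category: a class of kernel-cokernel
pairs, the conflations, closed under isomorphisms and satisfying Quillen's axioms. -/
structure ExactStructure (E : Type u) [Category.{v} E] [Preadditive E] where
  IsConflation : ShortComplex E → Prop
  of_iso : ∀ {S S' : ShortComplex E}, (S ≅ S') → IsConflation S → IsConflation S'
  isKernel : ∀ {S : ShortComplex E}, IsConflation S →
    Nonempty (IsLimit (KernelFork.ofι S.f S.zero))
  isCokernel : ∀ {S : ShortComplex E}, IsConflation S →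
    Nonempty (IsColimit (CokernelCofork.ofπ S.g S.zero))
  inflation_id : ∀ X : E, IsInflationFor IsConflation (𝟙 X)
  deflation_id : ∀ X : E, IsDeflationFor IsConflation (𝟙 X)
  inflation_comp : ∀ {X Y Z : E} (i : X ⟶ Y) (j : Y ⟶ Z),
    IsInflationFor IsConflation i → IsInflationFor IsConflation j →
      IsInflationFor IsConflation (i ≫ j)
  deflation_comp : ∀ {X Y Z : E} (p : X ⟶ Y) (q : Y ⟶ Z),
    IsDeflationFor IsConflation p → IsDeflationFor IsConflation q →
      IsDeflationFor IsConflation (p ≫ q)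
  exists_pushout : ∀ {X Y X' : E} (i : X ⟶ Y) (f : X ⟶ X'), IsInflationFor IsConflation i →
    ∃ (Y' : E) (f' : Y ⟶ Y') (i' : X' ⟶ Y'), IsPushout i f f' i' ∧
      IsInflationFor IsConflation i'
  exists_pullback : ∀ {Y Z Z' : E} (p : Y ⟶ Z) (f : Z' ⟶ Z), IsDeflationFor IsConflation p →
    ∃ (Y' : E) (f' : Y' ⟶ Y) (p' : Y' ⟶ Z'), IsPullback f' p' p f ∧
      IsDeflationFor IsConflation p'

namespace ExactStructure

variable {E : Type u} [Category.{v} E] [Preadditive E] (X : ExactStructure E)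

/-- Injective objects of an exact category: morphisms to them extend along inflations. -/
def IsInj (I : E) : Prop :=
  ∀ S : ShortComplex E, X.IsConflation S → ∀ f : S.X₁ ⟶ I, ∃ g : S.X₂ ⟶ I, S.f ≫ g = f

/-- Projective objects of an exact category: morphisms from them lift through deflations. -/
def IsProj (P : E) : Prop :=
  ∀ S : ShortComplex E, X.IsConflation S → ∀ f : P ⟶ S.X₃, ∃ g : P ⟶ S.X₂, g ≫ S.g = f

end ExactStructure

/-- A Frobenius structure: an exact structure with enough projectives and enough injectives, for
which the projective objects and the injective objects coincide. -/
structure FrobeniusStructure (E : Type u) [Category.{v} E] [Preadditive E] extends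
    ExactStructure E where
  enough_inj : ∀ M : E, ∃ (I N : E) (i : M ⟶ I) (p : I ⟶ N) (w : i ≫ p = 0),
    IsConflation (ShortComplex.mk i p w) ∧ toExactStructure.IsInj I
  enough_proj : ∀ M : E, ∃ (N P : E) (i : N ⟶ P) (p : P ⟶ M) (w : i ≫ p = 0),
    IsConflation (ShortComplex.mk i p w) ∧ toExactStructure.IsProj P
  proj_iff_inj : ∀ P : E, toExactStructure.IsProj P ↔ toExactStructure.IsInj P

/-! ## The stable category of a Frobenius category -/

namespace FrobeniusStructure

variable {E : Type u} [Category.{v} E] [Preadditive E]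

/-- Two parallel morphisms are identified in the stable category if their difference factors
through a projective-injective object. -/
def stableRel (F : FrobeniusStructure E) : HomRel E := fun X Y f g =>
  ∃ (P : E) (a : X ⟶ P) (b : P ⟶ Y), F.IsProj P ∧ F.IsInj P ∧ f - g = a ≫ b

/-- The stable category of a Frobenius category. -/
abbrev Stable (F : FrobeniusStructure E) := CategoryTheory.Quotient F.stableRel

/-- The canonical functor to the stable category. -/
abbrev proj (F : FrobeniusStructure E) : E ⥤ F.Stable := CategoryTheory.Quotient.functor F.stableRel

theorem isInj_biprod (X : ExactStructure E) {P P' : E} [HasBinaryBiproduct P P'] (h : X.IsInj P) (h' : X.IsInj P') :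
    X.IsInj (P ⊞ P') := by
  intro S hS f
  obtain ⟨g, hg⟩ := h S hS (f ≫ biprod.fst)
  obtain ⟨g', hg'⟩ := h' S hS (f ≫ biprod.snd)
  refine ⟨biprod.lift g g', ?_⟩
  ext <;> simp [hg, hg']

theorem stableRel_refl (F : FrobeniusStructure E) (X Y : E) (f : X ⟶ Y) : F.stableRel f f := by
  obtain ⟨I, N, i, p, w, _, hI⟩ := F.enough_inj X
  exact ⟨I, 0, 0, (F.proj_iff_inj _).2 hI, hI, by simp⟩

section

variable [HasFiniteBiproducts E]

theorem stableRel_add (F : FrobeniusStructure E) ⦃X Y : E⦄ (f₁ f₂ g₁ g₂ : X ⟶ Y)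
    (hf : F.stableRel f₁ f₂) (hg : F.stableRel g₁ g₂) :
    F.stableRel (f₁ + g₁) (f₂ + g₂) := by
  obtain ⟨P, a, b, _, hP, h⟩ := hf
  obtain ⟨P', a', b', _, hP', h'⟩ := hg
  have := hasBinaryBiproducts_of_finite_biproducts E
  have hI := isInj_biprod F.toExactStructure hP hP'
  refine ⟨P ⊞ P', biprod.lift a a', biprod.desc b b', (F.proj_iff_inj _).2 hI, hI, ?_⟩
  rw [biprod.lift_desc, ← h, ← h']
  abel

instance congruence_stableRel (F : FrobeniusStructure E) : Congruence F.stableRel where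
  comp_left f g g' := by
    rintro ⟨P, a, b, hP, hI, h⟩
    exact ⟨P, f ≫ a, b, hP, hI, by rw [← Preadditive.comp_sub, h, Category.assoc]⟩
  comp_right g := by
    rintro ⟨P, a, b, hP, hI, h⟩
    exact ⟨P, a, b ≫ g, hP, hI, by rw [← Preadditive.sub_comp, h, Category.assoc]⟩
  equivalence :=
    { refl := fun f => F.stableRel_refl _ _ f
      symm := by
        rintro f g ⟨P, a, b, hP, hI, h⟩
        exact ⟨P, -a, b, hP, hI, by rw [Preadditive.neg_comp, ← h]; abel⟩
      trans := by
        intro f g l hfg hgl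
        have h := F.stableRel_add _ _ _ _ hfg hgl
        obtain ⟨P, a, b, hP, hI, h⟩ := h
        exact ⟨P, a, b, hP, hI, by rw [← h]; abel⟩ }

instance preadditiveStable (F : FrobeniusStructure E) : Preadditive F.Stable :=
  CategoryTheory.Quotient.preadditive F.stableRel F.stableRel_add

instance additive_proj (F : FrobeniusStructure E) : F.proj.Additive :=
  CategoryTheory.Quotient.functor_additive F.stableRel F.stableRel_add

instance linearStable {k : Type*} [Field k] [Linear k E] (F : FrobeniusStructure E) :
    Linear k F.Stable :=
  CategoryTheory.Quotient.linear k F.stableRel (by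
    rintro c X Y f g ⟨P, a, b, hP, hI, h⟩
    exact ⟨P, c • a, b, hP, hI, by rw [Linear.smul_comp, ← h, smul_sub]⟩)

end

/-! ### The suspension functor

For each object `M`, a conflation `M → IM → ΣM` with `IM` injective is fixed. -/

/-- The object `IM` of the fixed conflation `M → IM → ΣM`. -/
def hull (F : FrobeniusStructure E) (M : E) : E := (F.enough_inj M).choose

/-- The object `ΣM` of the fixed conflation `M → IM → ΣM`. -/
def cosyz (F : FrobeniusStructure E) (M : E) : E := (F.enough_inj M).choose_spec.choose

/-- The inflation of the fixed conflation `M → IM → ΣM`. -/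
def hullι (F : FrobeniusStructure E) (M : E) : M ⟶ F.hull M :=
  (F.enough_inj M).choose_spec.choose_spec.choose

/-- The deflation of the fixed conflation `M → IM → ΣM`. -/
def hullπ (F : FrobeniusStructure E) (M : E) : F.hull M ⟶ F.cosyz M :=
  (F.enough_inj M).choose_spec.choose_spec.choose_spec.choose

theorem hull_zero (F : FrobeniusStructure E) (M : E) : F.hullι M ≫ F.hullπ M = 0 :=
  (F.enough_inj M).choose_spec.choose_spec.choose_spec.choose_spec.choose

theorem hull_conflation (F : FrobeniusStructure E) (M : E) :
    F.IsConflation (ShortComplex.mk (F.hullι M) (F.hullπ M) (F.hull_zero M)) :=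
  (F.enough_inj M).choose_spec.choose_spec.choose_spec.choose_spec.choose_spec.1

theorem hull_inj (F : FrobeniusStructure E) (M : E) : F.IsInj (F.hull M) :=
  (F.enough_inj M).choose_spec.choose_spec.choose_spec.choose_spec.choose_spec.2

/-- `g : S.X₃ ⟶ ΣM` is induced by `f : S.X₁ ⟶ M`: there is a morphism of conflations `(f, h, g)`
from `S` to `M → IM → ΣM`. -/
def Induces (F : FrobeniusStructure E) (S : ShortComplex E) {M : E} (f : S.X₁ ⟶ M)
    (g : S.X₃ ⟶ F.cosyz M) : Prop :=
  ∃ h : S.X₂ ⟶ F.hull M, S.f ≫ h = f ≫ F.hullι M ∧ S.g ≫ g = h ≫ F.hullπ M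

theorem conflation_desc (F : FrobeniusStructure E) {S : ShortComplex E} (hS : F.IsConflation S)
    {Z : E} (h : S.X₂ ⟶ Z) (w : S.f ≫ h = 0) : ∃ g : S.X₃ ⟶ Z, S.g ≫ g = h := by
  obtain ⟨hc⟩ := F.isCokernel hS
  exact ⟨hc.desc (CokernelCofork.ofπ h w), hc.fac _ WalkingParallelPair.one⟩

theorem conflation_epi (F : FrobeniusStructure E) {S : ShortComplex E} (hS : F.IsConflation S) :
    Epi S.g := by
  obtain ⟨hc⟩ := F.isCokernel hS
  exact ⟨fun _ _ h => Cofork.IsColimit.hom_ext hc h⟩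

theorem exists_induces (F : FrobeniusStructure E) {S : ShortComplex E} (hS : F.IsConflation S)
    {M : E} (f : S.X₁ ⟶ M) : ∃ g : S.X₃ ⟶ F.cosyz M, F.Induces S f g := by
  obtain ⟨h, hh⟩ := F.hull_inj M S hS (f ≫ F.hullι M)
  obtain ⟨g, hg⟩ := F.conflation_desc hS (h ≫ F.hullπ M)
    (by rw [← Category.assoc, hh, Category.assoc, hull_zero, comp_zero])
  exact ⟨g, h, hh, hg⟩

theorem Induces.stableRel {F : FrobeniusStructure E} {S : ShortComplex E}
    (hS : F.IsConflation S) {M : E} {f f' : S.X₁ ⟶ M} {g g' : S.X₃ ⟶ F.cosyz M}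
    (hg : F.Induces S f g) (hg' : F.Induces S f' g') (hf : F.stableRel f f') :
    F.stableRel g g' := by
  obtain ⟨h, h1, h2⟩ := hg
  obtain ⟨h', h1', h2'⟩ := hg'
  obtain ⟨P, a, b, _, hI, hab⟩ := hf
  obtain ⟨c, hc⟩ := hI S hS a
  obtain ⟨t, ht⟩ := F.conflation_desc hS (h - h' - c ≫ b ≫ F.hullι M) (by
    rw [Preadditive.comp_sub, Preadditive.comp_sub, h1, h1', ← Category.assoc S.f, hc,
      ← Preadditive.sub_comp, hab, Category.assoc, sub_self])
  have := F.conflation_epi hS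
  refine ⟨F.hull M, t, F.hullπ M, (F.proj_iff_inj _).2 (F.hull_inj M), F.hull_inj M, ?_⟩
  rw [← cancel_epi S.g, ← Category.assoc, ht, Preadditive.comp_sub, h2, h2']
  simp [hull_zero]

/-- A morphism `ΣM → ΣN` induced by `f : M ⟶ N`. -/
def suspMap (F : FrobeniusStructure E) {M N : E} (f : M ⟶ N) : F.cosyz M ⟶ F.cosyz N :=
  (F.exists_induces (F.hull_conflation M) f).choose

theorem suspMap_induces (F : FrobeniusStructure E) {M N : E} (f : M ⟶ N) :
    F.Induces (ShortComplex.mk (F.hullι M) (F.hullπ M) (F.hull_zero M)) f (F.suspMap f) :=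
  (F.exists_induces (F.hull_conflation M) f).choose_spec

section

variable [HasFiniteBiproducts E]

/-- The functor `E ⥤ F.Stable` inducing the suspension functor. -/
def preSusp (F : FrobeniusStructure E) : E ⥤ F.Stable where
  obj M := F.proj.obj (F.cosyz M)
  map f := F.proj.map (F.suspMap f)
  map_id M := by
    rw [← F.proj.map_id]
    refine CategoryTheory.Quotient.sound _ ?_
    refine Induces.stableRel (F.hull_conflation M) (F.suspMap_induces _) ?_
      (F.stableRel_refl _ _ (𝟙 M))
    exact ⟨𝟙 _, by simp, by simp⟩
  map_comp {M N K} f g := by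
    rw [← F.proj.map_comp]
    refine CategoryTheory.Quotient.sound _ ?_
    refine Induces.stableRel (F.hull_conflation M) (F.suspMap_induces _) ?_
      (F.stableRel_refl _ _ (f ≫ g))
    obtain ⟨h, h1, h2⟩ := F.suspMap_induces f
    obtain ⟨l, l1, l2⟩ := F.suspMap_induces g
    dsimp at h h1 h2 l l1 l2
    refine ⟨h ≫ l, ?_, ?_⟩
    · dsimp
      rw [← Category.assoc, h1, Category.assoc, l1, Category.assoc]
    · dsimp
      rw [← Category.assoc, h2, Category.assoc, l2, Category.assoc]

/-- The suspension functor `Σ` of the stable category. -/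
def susp (F : FrobeniusStructure E) : F.Stable ⥤ F.Stable :=
  CategoryTheory.Quotient.lift F.stableRel F.preSusp (fun M _ f g h =>
    CategoryTheory.Quotient.sound _
      (Induces.stableRel (F.hull_conflation M) (F.suspMap_induces f) (F.suspMap_induces g) h))

/-- The triangles `M → Y → L → ΣM` of the stable category: the standard triangle of a conflation
`A → B → C` of `E` is `A → B → C → ΣA`, where `e : C ⟶ ΣA` is induced by the identity of `A`, i.e.
`A → B → C` is the pull-back of `A → IA → ΣA` along `e`; the triangles are the sequences
isomorphic to standard ones. -/
def IsTriangle (F : FrobeniusStructure E) {M Y L : F.Stable}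
    (i : M ⟶ Y) (p : Y ⟶ L) (ε : L ⟶ F.susp.obj M) : Prop :=
  ∃ (S : ShortComplex E) (e : S.X₃ ⟶ F.cosyz S.X₁)
    (α : M ≅ F.proj.obj S.X₁) (β : Y ≅ F.proj.obj S.X₂) (γ : L ≅ F.proj.obj S.X₃),
    F.IsConflation S ∧ F.Induces S (𝟙 S.X₁) e ∧
    i ≫ β.hom = α.hom ≫ F.proj.map S.f ∧
    p ≫ γ.hom = β.hom ≫ F.proj.map S.g ∧
    ε ≫ F.susp.map α.hom = γ.hom ≫ F.proj.map e

/-! ### Constructible cones -/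

variable (k : Type*) [Field k] [Linear k E]

/-- The map sending `ε : L ⟶ ΣM` to the orbit of the sequence of right `End T`-modules
`Hom(T, M) → Hom(T, Y) → Hom(T, L) → Hom(T, ΣM)`, where `M → Y → L → ΣM` is a triangle with third
morphism `ε`, lifts to a constructible map from `Hom(L, ΣM)` to the disjoint union of the
varieties of matrix representations of `A₄` with dimension vector in `D` (a finite set). That the
map to the set of orbits is well defined, with values in the orbits of matrix representations with
dimension vector in `D`, is part of the assertion. -/
def HasConstructibleLift (F : FrobeniusStructure E) (T L M : F.Stable)
    (D : Set (QuiverA4 → ℕ)) : Prop :=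
  ∃ φ : (L ⟶ F.susp.obj M) → Σ d : D, MatRep k (End T) QuiverA4 d.1,
    IsConstructibleMap (affineSpaceRing k (L ⟶ F.susp.obj M))
      (sigmaRing fun d : D => MatRep.coordinateRing k (End T) QuiverA4 d.1) φ ∧
    ∀ ε : L ⟶ F.susp.obj M,
      (∃ (Y : F.Stable) (i : M ⟶ Y) (p : Y ⟶ L), F.IsTriangle i p ε) ∧
      ∀ (Y : F.Stable) (i : M ⟶ Y) (p : Y ⟶ L), F.IsTriangle i p ε →
        (φ ε).2 ∈ homOrbit k T (QuiverA4.diagram i p ε) (φ ε).1.1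

/-- The stable category has constructible cones: for all objects `T`, `L`, `M`, the cylinders over
the morphisms `L ⟶ ΣM` are constructible with respect to `T`. -/
def HasConstructibleCones (F : FrobeniusStructure E) : Prop :=
  ∀ T L M : F.Stable, F.HasConstructibleLift k T L M
    (Set.Iic (QuiverA4.dimVec (Module.finrank k (T ⟶ M))
      (Module.finrank k (T ⟶ M) + Module.finrank k (T ⟶ L))
      (Module.finrank k (T ⟶ L)) (Module.finrank k (T ⟶ F.susp.obj M))))

end

end FrobeniusStructure

end

/-! Choose a linear section `σ` of the projection `E(L, ΣM) → C(L, ΣM)` and let `Y` be the pull-back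
of `IM → ΣM` along `σ ε`. For every `X` in `E`, the space `E(X, Y)` is the kernel of `(u, v) ↦ u π -
v σ(ε)` on the fixed space `E(X, IM) × E(X, L)`, and the matrix of this map is affine in `ε`. A
morphism `T → Y` is stably zero exactly when it factors through `T → IT`. Hence `C(T, Y)` is a
subquotient `ker M(ε) / D (ker N(ε))` with `D` constant (`exists_linearEquiv_middle`).

Linear algebra in families (`exists_basis_subquotient`) gives such subquotients bases that are
rational in `ε` on finitely many strata, each cut out by vanishing and non-vanishing of polynomials.
In these bases, and in fixed bases of the other three spaces, all matrix entries of the sequence are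
piecewise rational. As `rep_d` has a finitely generated coordinate ring, this yields
constructibility (`isConstructibleMap_sigma`).

The orbit does not depend on the triangle: two triangles on the same `ε` are linked by morphisms in
both directions, each surjective on `C(T, -)` by a diagram chase, hence bijective by finite
dimension. Exactness comes from correcting representatives in `E` by stably trivial morphisms, which
lift through deflations. -/

noncomputable section

/-! ## Piecewise rational functions -/

section Piecewise

variable {k : Type*} [Field k] {X : Type*}

/-- The points `x` and `y` are zeros of the same elements of `P`. -/
def SameZeros (P : Set (X → k)) (x y : X) : Prop := ∀ p ∈ P, p x = 0 ↔ p y = 0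

theorem SameZeros.mono {P P' : Set (X → k)} (h : P ⊆ P') {x y : X} (hxy : SameZeros P' x y) :
    SameZeros P x y := fun p hp => hxy p (h hp)

/-- The function `f` is constant on the strata cut out by finitely many elements of `A`. -/
def IsPiecewiseConstant (A : Subalgebra k (X → k)) {α : Sort*} (f : X → α) : Prop :=
  ∃ P : Set (X → k), P.Finite ∧ P ⊆ A ∧ ∀ x y, SameZeros P x y → f x = f y

/-- The function `f` is a quotient of two elements of `A` on each of the strata cut out by
finitely many elements of `A`. -/
def IsPiecewiseRational (A : Subalgebra k (X → k)) (f : X → k) : Prop :=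
  ∃ P : Set (X → k), P.Finite ∧ P ⊆ A ∧ ∃ Q : Set ((X → k) × (X → k)), Q.Finite ∧
    (∀ r ∈ Q, r.1 ∈ A ∧ r.2 ∈ A) ∧
    ∀ x, ∃ r ∈ Q, ∀ y, SameZeros P x y → r.2 y ≠ 0 ∧ f y = r.1 y / r.2 y

variable {A : Subalgebra k (X → k)}

namespace IsPiecewiseConstant

theorem comp {α β : Sort*} {f : X → α} (hf : IsPiecewiseConstant A f) (g : α → β) :
    IsPiecewiseConstant A (fun x => g (f x)) := by
  obtain ⟨P, hP, hPA, h⟩ := hf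
  exact ⟨P, hP, hPA, fun x y hxy => congrArg g (h x y hxy)⟩

theorem pi {ι : Type*} [Finite ι] {α : ι → Sort*} {f : ∀ i, X → α i}
    (hf : ∀ i, IsPiecewiseConstant A (f i)) : IsPiecewiseConstant A (fun x i => f i x) := by
  choose P hP hPA h using hf
  exact ⟨⋃ i, P i, Set.finite_iUnion hP, Set.iUnion_subset hPA, fun x y hxy =>
    funext fun i => h i x y (hxy.mono (Set.subset_iUnion P i))⟩

theorem and {c d : X → Prop} (hc : IsPiecewiseConstant A c) (hd : IsPiecewiseConstant A d) :
    IsPiecewiseConstant A (fun x => c x ∧ d x) := by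
  obtain ⟨P, hP, hPA, h⟩ := hc
  obtain ⟨P', hP', hPA', h'⟩ := hd
  exact ⟨P ∪ P', hP.union hP', Set.union_subset hPA hPA', fun x y hxy =>
    congrArg₂ And (h x y (hxy.mono Set.subset_union_left))
      (h' x y (hxy.mono Set.subset_union_right))⟩

theorem exists_select {ι : Type*} [Finite ι] {S : ι → X → Prop}
    (hS : ∀ i, IsPiecewiseConstant A (S i)) (hcov : ∀ x, ∃ i, S i x) :
    ∃ s : X → ι, IsPiecewiseConstant A s ∧ ∀ x, S (s x) x := by
  obtain ⟨P, hP, hPA, h⟩ := pi hS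
  -- The index chosen by `Exists.choose` depends only on the predicate of admissible indices, which
  -- is piecewise constant.
  have key : ∀ (p q : ι → Prop) (_ : p = q) (hp : ∃ i, p i) (hq : ∃ i, q i),
      hp.choose = hq.choose := by
    rintro p _ rfl _ _
    rfl
  exact ⟨fun x => (hcov x).choose, ⟨P, hP, hPA, fun x y hxy => key _ _ (h x y hxy) _ _⟩,
    fun x => (hcov x).choose_spec⟩

end IsPiecewiseConstant

namespace IsPiecewiseRational

theorem of_mem {f : X → k} (hf : f ∈ A) : IsPiecewiseRational A f :=
  ⟨∅, Set.finite_empty, Set.empty_subset _, {(f, 1)}, Set.finite_singleton _,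
    by rintro _ rfl; exact ⟨hf, A.one_mem⟩, fun _ => ⟨_, rfl, by simp⟩⟩

theorem add {f g : X → k} (hf : IsPiecewiseRational A f) (hg : IsPiecewiseRational A g) :
    IsPiecewiseRational A (f + g) := by
  obtain ⟨P, hP, hPA, Q, hQ, hQA, h⟩ := hf
  obtain ⟨P', hP', hPA', Q', hQ', hQA', h'⟩ := hg
  refine ⟨P ∪ P', hP.union hP', Set.union_subset hPA hPA',
    Set.image2 (fun r s => (r.1 * s.2 + r.2 * s.1, r.2 * s.2)) Q Q', hQ.image2 _ hQ', ?_, ?_⟩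
  · rintro _ ⟨r, hr, s, hs, rfl⟩
    exact ⟨A.add_mem (A.mul_mem (hQA r hr).1 (hQA' s hs).2) (A.mul_mem (hQA r hr).2 (hQA' s hs).1),
      A.mul_mem (hQA r hr).2 (hQA' s hs).2⟩
  · intro x
    obtain ⟨r, hr, hr'⟩ := h x
    obtain ⟨s, hs, hs'⟩ := h' x
    refine ⟨_, ⟨r, hr, s, hs, rfl⟩, fun y hy => ?_⟩
    obtain ⟨h1, h2⟩ := hr' y (hy.mono Set.subset_union_left)
    obtain ⟨h3, h4⟩ := hs' y (hy.mono Set.subset_union_right)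
    exact ⟨mul_ne_zero h1 h3, by simp [h2, h4, div_add_div _ _ h1 h3]⟩

theorem mul {f g : X → k} (hf : IsPiecewiseRational A f) (hg : IsPiecewiseRational A g) :
    IsPiecewiseRational A (f * g) := by
  obtain ⟨P, hP, hPA, Q, hQ, hQA, h⟩ := hf
  obtain ⟨P', hP', hPA', Q', hQ', hQA', h'⟩ := hg
  refine ⟨P ∪ P', hP.union hP', Set.union_subset hPA hPA',
    Set.image2 (fun r s => (r.1 * s.1, r.2 * s.2)) Q Q', hQ.image2 _ hQ', ?_, ?_⟩
  · rintro _ ⟨r, hr, s, hs, rfl⟩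
    exact ⟨A.mul_mem (hQA r hr).1 (hQA' s hs).1, A.mul_mem (hQA r hr).2 (hQA' s hs).2⟩
  · intro x
    obtain ⟨r, hr, hr'⟩ := h x
    obtain ⟨s, hs, hs'⟩ := h' x
    refine ⟨_, ⟨r, hr, s, hs, rfl⟩, fun y hy => ?_⟩
    obtain ⟨h1, h2⟩ := hr' y (hy.mono Set.subset_union_left)
    obtain ⟨h3, h4⟩ := hs' y (hy.mono Set.subset_union_right)
    exact ⟨mul_ne_zero h1 h3, by simp [h2, h4, div_mul_div_comm]⟩

/-- Once the numerators join the functions cutting out the strata, each numerator vanishes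
everywhere or nowhere on a stratum. In the first case the inverse is `0 / 1`, by the convention `0⁻¹
= 0`; in the second the quotient is turned over. -/
theorem inv {f : X → k} (hf : IsPiecewiseRational A f) : IsPiecewiseRational A f⁻¹ := by
  obtain ⟨P, hP, hPA, Q, hQ, hQA, h⟩ := hf
  refine ⟨P ∪ Prod.fst '' Q, hP.union (hQ.image _), Set.union_subset hPA ?_,
    insert (0, 1) (Prod.swap '' Q), (hQ.image _).insert _, ?_, ?_⟩
  · rintro _ ⟨r, hr, rfl⟩
    exact (hQA r hr).1
  · rintro _ (rfl | ⟨r, hr, rfl⟩)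
    exacts [⟨A.zero_mem, A.one_mem⟩, (hQA r hr).symm]
  · intro x
    obtain ⟨r, hr, hr'⟩ := h x
    by_cases h0 : r.1 x = 0
    · refine ⟨_, Set.mem_insert _ _, fun y hy => ⟨one_ne_zero, ?_⟩⟩
      rw [Pi.inv_apply, (hr' y (hy.mono Set.subset_union_left)).2,
        (hy r.1 (Or.inr ⟨r, hr, rfl⟩)).1 h0]
      simp
    · refine ⟨_, Set.mem_insert_of_mem _ ⟨r, hr, rfl⟩, fun y hy => ⟨?_, ?_⟩⟩
      · exact fun h => h0 ((hy r.1 (Or.inr ⟨r, hr, rfl⟩)).2 h)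
      · rw [Pi.inv_apply, (hr' y (hy.mono Set.subset_union_left)).2, inv_div]
        rfl

theorem isPiecewiseConstant_eq_zero {f : X → k} (hf : IsPiecewiseRational A f) :
    IsPiecewiseConstant A (fun x => f x = 0) := by
  obtain ⟨P, hP, hPA, Q, hQ, hQA, h⟩ := hf
  refine ⟨P ∪ Prod.fst '' Q, hP.union (hQ.image _), Set.union_subset hPA ?_, ?_⟩
  · rintro _ ⟨r, hr, rfl⟩
    exact (hQA r hr).1
  · intro x y hxy
    obtain ⟨r, hr, hr'⟩ := h x
    obtain ⟨h1, h2⟩ := hr' x fun _ _ => Iff.rfl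
    obtain ⟨h3, h4⟩ := hr' y (hxy.mono Set.subset_union_left)
    simp only [h2, h4, div_eq_zero_iff, h1, h3, or_false]
    exact propext (hxy r.1 (Or.inr ⟨r, hr, rfl⟩))

theorem select {ι : Type*} [Finite ι] {s : X → ι} (hs : IsPiecewiseConstant A s) {f : ι → X → k}
    (hf : ∀ i, IsPiecewiseRational A (f i)) : IsPiecewiseRational A (fun x => f (s x) x) := by
  obtain ⟨P, hP, hPA, h⟩ := hs
  choose P' hP' hPA' Q hQ hQA h' using hf
  refine ⟨P ∪ ⋃ i, P' i, hP.union (Set.finite_iUnion hP'),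
    Set.union_subset hPA (Set.iUnion_subset hPA'), ⋃ i, Q i, Set.finite_iUnion hQ, ?_, ?_⟩
  · intro r hr
    obtain ⟨i, hi⟩ := Set.mem_iUnion.1 hr
    exact hQA i r hi
  · intro x
    obtain ⟨r, hr, hr'⟩ := h' (s x) x
    refine ⟨r, Set.mem_iUnion.2 ⟨_, hr⟩, fun y hy => ?_⟩
    beta_reduce
    rw [← h x y (hy.mono Set.subset_union_left)]
    exact hr' y (hy.mono ((Set.subset_iUnion P' _).trans Set.subset_union_right))

end IsPiecewiseRational

/-! ### Strata and constructible maps -/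

variable (A) in
/-- The algebra of piecewise rational functions. -/
def piecewiseRational : Subalgebra k (X → k) where
  carrier := {f | IsPiecewiseRational A f}
  mul_mem' := .mul
  add_mem' := .add
  algebraMap_mem' c := .of_mem (A.algebraMap_mem c)

theorem isLocallyClosed_stratum (P : Set (X → k)) (hP : P.Finite) (hPA : P ⊆ A)
    (σ : Set (X → k)) :
    @IsLocallyClosed X (zariskiTopology A) {x | {p ∈ P | p x = 0} = σ} := by
  let _ := zariskiTopology A
  have hopen : ∀ p ∈ P, IsOpen {x | p x ≠ 0} := fun p hp =>
    TopologicalSpace.isOpen_generateFrom_of_mem ⟨p, hPA hp, rfl⟩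
  by_cases hσ : σ ⊆ P
  · have : {x | {p ∈ P | p x = 0} = σ} =
        (⋂ p ∈ P \ σ, {x | p x ≠ 0}) ∩ ⋂ p ∈ σ, {x | p x = 0} := by
      ext x
      simp only [Set.mem_ofPred_eq, Set.mem_inter_iff, Set.mem_iInter, Set.ext_iff, Set.mem_sdiff]
      constructor
      · intro h
        exact ⟨fun p hp h0 => hp.2 ((h p).1 ⟨hp.1, h0⟩), fun p hp => ((h p).2 hp).2⟩
      · rintro ⟨h1, h2⟩ p
        exact ⟨fun hp => by_contra fun h => h1 p ⟨hp.1, h⟩ hp.2, fun hp => ⟨hσ hp, h2 p hp⟩⟩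
    rw [this]
    refine ⟨_, _, ?_, ?_, rfl⟩
    · exact (hP.subset Set.sdiff_subset).isOpen_biInter fun p hp => hopen p hp.1
    · refine isClosed_biInter fun p hp => ⟨?_⟩
      exact hopen p (hσ hp)
  -- A zero pattern that is not contained in `P` occurs at no point.
  · convert isOpen_empty.isLocallyClosed
    refine Set.eq_empty_of_forall_notMem fun x hx => hσ ?_
    rw [← Set.mem_ofPred.1 hx]
    exact Set.sep_subset _ _

/-- A map to a disjoint union of affine varieties is constructible if its components are piecewise
rational, on pieces where the component hit is constant. -/
theorem isConstructibleMap_sigma {D : Type*} {Y : D → Type*} {A' : ∀ d, Subalgebra k (Y d → k)}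
    {G₀ : ∀ d, Set (Y d → k)} (hA' : ∀ d, ∃ G ⊆ G₀ d, G.Finite ∧ A' d = Algebra.adjoin k G)
    (φ : X → Σ d, Y d) {ι : Type*} [Finite ι] (s : X → ι) (hs : IsPiecewiseConstant A s)
    (hd : ∀ x y, s x = s y → (φ x).1 = (φ y).1)
    (hφ : ∀ i d, ∀ g ∈ G₀ d, ∃ f, IsPiecewiseRational A f ∧
      ∀ x y, s x = i → φ x = ⟨d, y⟩ → g y = f x) :
    IsConstructibleMap A (sigmaRing A') φ := by
  -- The pieces must be fixed before the regular function `g` is given. So `P` comes from the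
  -- finitely many generators alone, and sums and products of quotients keep non-vanishing
  -- denominators on the same strata.
  have key : ∀ i, ∃ P : Set (X → k), P.Finite ∧ P ⊆ A ∧ ∀ x₀, s x₀ = i →
      ∀ g ∈ A' (φ x₀).1, ∃ p ∈ A, ∃ q ∈ A, ∀ x y, SameZeros P x₀ x → s x = i →
        φ x = ⟨(φ x₀).1, y⟩ → q x ≠ 0 ∧ g y = p x / q x := by
    intro i
    by_cases hi : ∃ x₁, s x₁ = i
    swap
    · exact ⟨∅, Set.finite_empty, Set.empty_subset _, fun x₀ h => (hi ⟨x₀, h⟩).elim⟩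
    obtain ⟨x₁, hx₁⟩ := hi
    obtain ⟨G, hG₀, hG, hGA⟩ := hA' (φ x₁).1
    have := hG.to_subtype
    choose f hf hf' using fun g : G => hφ i (φ x₁).1 g.1 (hG₀ g.2)
    choose P hP hPA Q hQ hQA h using hf
    refine ⟨⋃ g, P g, Set.finite_iUnion hP, Set.iUnion_subset hPA, fun x₀ hx₀ => ?_⟩
    rw [hd x₀ x₁ (hx₀.trans hx₁.symm)]
    intro g hg
    rw [hGA] at hg
    induction hg using Algebra.adjoin_induction with
    | mem g hg =>
      obtain ⟨r, hr, hr'⟩ := h ⟨g, hg⟩ x₀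
      refine ⟨r.1, (hQA _ r hr).1, r.2, (hQA _ r hr).2, fun x y hxy hx hφx => ?_⟩
      rw [show g y = _ from hf' ⟨g, hg⟩ x y hx hφx]
      exact hr' x (hxy.mono (Set.subset_iUnion P _))
    | algebraMap c => exact ⟨_, A.algebraMap_mem c, 1, A.one_mem, fun x y _ _ _ => by simp⟩
    | add g g' _ _ h h' =>
      obtain ⟨p, hp, q, hq, h⟩ := h
      obtain ⟨p', hp', q', hq', h'⟩ := h'
      refine ⟨p * q' + q * p', A.add_mem (A.mul_mem hp hq') (A.mul_mem hq hp'), q * q',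
        A.mul_mem hq hq', fun x y h1 h2 h3 => ?_⟩
      obtain ⟨h4, h5⟩ := h x y h1 h2 h3
      obtain ⟨h6, h7⟩ := h' x y h1 h2 h3
      exact ⟨mul_ne_zero h4 h6, by simp [h5, h7, div_add_div _ _ h4 h6]⟩
    | mul g g' _ _ h h' =>
      obtain ⟨p, hp, q, hq, h⟩ := h
      obtain ⟨p', hp', q', hq', h'⟩ := h'
      refine ⟨p * p', A.mul_mem hp hp', q * q', A.mul_mem hq hq', fun x y h1 h2 h3 => ?_⟩
      obtain ⟨h4, h5⟩ := h x y h1 h2 h3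
      obtain ⟨h6, h7⟩ := h' x y h1 h2 h3
      exact ⟨mul_ne_zero h4 h6, by simp [h5, h7, div_mul_div_comm]⟩
  obtain ⟨P, hP, hPA, hPs⟩ := hs
  choose P' hP' hPA' h using key
  let R : Set (X → k) := P ∪ ⋃ i, P' i
  have hR : R.Finite := hP.union (Set.finite_iUnion hP')
  have hRA : R ⊆ A := Set.union_subset hPA (Set.iUnion_subset hPA')
  -- The pieces are indexed by the possible zero patterns, that is, the subsets of `R`.
  have := hR.finite_subsets.to_subtype
  obtain ⟨n, ⟨e⟩⟩ := Finite.exists_equiv_fin {σ : Set (X → k) | σ ⊆ R}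
  refine ⟨n, fun j => {x | {p ∈ R | p x = 0} = (e.symm j).1},
    fun j => isLocallyClosed_stratum R hR hRA _, ?_, ?_, ?_⟩
  · intro j j' hjj
    refine Set.disjoint_left.2 fun x hx hx' => hjj (e.symm.injective (Subtype.ext ?_))
    exact (Set.mem_ofPred.1 hx).symm.trans hx'
  · refine Set.eq_univ_of_forall fun x => Set.mem_iUnion.2
      ⟨e ⟨{p ∈ R | p x = 0}, Set.sep_subset _ _⟩, ?_⟩
    simp
  · intro j g hg x₀ hx₀
    obtain ⟨p, hp, q, hq, hpq⟩ := h (s x₀) x₀ rfl _ (hg (φ x₀).1)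
    have hsame : ∀ x ∈ {x | {p ∈ R | p x = 0} = (e.symm j).1}, SameZeros R x₀ x := by
      intro x hx p hp
      have := Set.ext_iff.1 ((Set.mem_ofPred.1 hx₀).trans (Set.mem_ofPred.1 hx).symm) p
      simpa [hp] using this
    have hval : ∀ x ∈ {x | {p ∈ R | p x = 0} = (e.symm j).1}, q x ≠ 0 ∧ (g ∘ φ) x = p x / q x := by
      intro x hx
      have hsx : s x = s x₀ := (hPs _ _ ((hsame x hx).mono Set.subset_union_left)).symm
      obtain ⟨d, y, hφx⟩ : ∃ d y, φ x = ⟨d, y⟩ := ⟨_, _, rfl⟩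
      have hdd : (φ x₀).1 = d := by rw [hd x₀ x hsx.symm, hφx]
      subst hdd
      have := hpq x y ((hsame x hx).mono
        ((Set.subset_iUnion P' _).trans Set.subset_union_right)) hsx hφx
      rw [Function.comp_apply, hφx]
      exact this
    exact ⟨p, hp, q, hq, (hval x₀ hx₀).1, fun x hx _ => (hval x hx).2⟩

end Piecewise

/-! ## Linear algebra in families -/

section Families

variable {k : Type*} [Field k]

open Matrix

/-- The columns contain a basis of the column space; `W` records the coordinates of every column in
it. -/
theorem Matrix.exists_linearIndependent_col {m n : Type*} [Fintype m] [Fintype n]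
    (M : Matrix m n k) : ∃ γ : Fin M.rank → n, LinearIndependent k (M.submatrix id γ).col ∧
      ∃ W : Matrix (Fin M.rank) n k, M.submatrix id γ * W = M := by
  rw [rank_eq_finrank_span_cols]
  obtain ⟨f, hf, hspan, hli⟩ := Submodule.exists_fun_fin_finrank_span_eq k (Set.range M.col)
  choose γ hγ using hf
  have hγ' : (M.submatrix id γ).col = f := funext hγ
  refine ⟨γ, hγ' ▸ hli, ?_⟩
  have h : ∀ j, ∃ w, M.submatrix id γ *ᵥ w = M.col j := fun j => by
    have : M.col j ∈ LinearMap.range (M.submatrix id γ).mulVecLin := by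
      rw [range_mulVecLin, hγ', hspan]
      exact Submodule.subset_span ⟨j, rfl⟩
    exact this
  choose w hw using h
  exact ⟨(Matrix.of w)ᵀ, Matrix.ext fun i j => congrFun (hw j) i⟩

/-- The skeleton decomposition of a matrix. -/
theorem Matrix.exists_eq_submatrix_mul {m n : Type*} [Fintype m] [Fintype n]
    (M : Matrix m n k) : ∃ (r : ℕ) (ρ : Fin r → m) (γ : Fin r → n),
      r ≤ Fintype.card n ∧ IsUnit (M.submatrix ρ γ).det ∧
        M.submatrix id γ * (M.submatrix ρ γ)⁻¹ * M.submatrix ρ id = M := by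
  obtain ⟨γ, hγ, W, hW⟩ := M.exists_linearIndependent_col
  -- Column selection for the transpose picks independent rows, which gives an invertible square
  -- minor.
  obtain ⟨ρ, hρ, -⟩ := (M.submatrix id γ)ᵀ.exists_linearIndependent_col
  have hr : (M.submatrix id γ)ᵀ.rank = M.rank := by
    rw [rank_transpose, rank_eq_finrank_span_cols, finrank_span_eq_card hγ, Fintype.card_fin]
  let ρ' : Fin M.rank → m := fun i => ρ (Fin.cast hr.symm i)
  have hu : IsUnit (M.submatrix ρ' γ).det := by
    rw [← isUnit_iff_isUnit_det, ← linearIndependent_rows_iff_isUnit]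
    exact hρ.comp (Fin.cast hr.symm) (Fin.cast_injective _)
  refine ⟨_, ρ', γ, M.rank_le_card_width, hu, ?_⟩
  have h1 : M.submatrix ρ' id = M.submatrix ρ' γ * W :=
    (congrArg (fun N : Matrix m n k => N.submatrix ρ' id) hW).symm
  rw [h1, Matrix.mul_assoc, Matrix.nonsing_inv_mul_cancel_left _ _ hu, hW]

/-! ### Families of matrices with piecewise rational entries -/

section

variable {X : Type*} {A : Subalgebra k (X → k)}

variable (A) in
/-- The entries of the matrices `M x` are piecewise rational functions of `x`. -/
def IsRationalFamily {m n : Type*} (M : X → Matrix m n k) : Prop :=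
  ∀ i j, (fun x => M x i j) ∈ piecewiseRational A

namespace IsRationalFamily

variable {l m n : Type*}

theorem const (M : Matrix m n k) : IsRationalFamily A fun _ => M := fun i j =>
  (piecewiseRational A).algebraMap_mem (M i j)

theorem sub {M N : X → Matrix m n k} (hM : IsRationalFamily A M) (hN : IsRationalFamily A N) :
    IsRationalFamily A fun x => M x - N x := fun i j =>
  (piecewiseRational A).sub_mem (hM i j) (hN i j)

theorem mul [Fintype m] {M : X → Matrix l m k} {N : X → Matrix m n k}
    (hM : IsRationalFamily A M) (hN : IsRationalFamily A N) :
    IsRationalFamily A fun x => M x * N x := fun i j => by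
  convert (piecewiseRational A).sum_mem fun a (_ : a ∈ Finset.univ) =>
    (piecewiseRational A).mul_mem (hM i a) (hN a j)
  simp [Matrix.mul_apply]

theorem submatrix {l' m' : Type*} {M : X → Matrix l m k} (hM : IsRationalFamily A M)
    (ρ : l' → l) (γ : m' → m) : IsRationalFamily A fun x => (M x).submatrix ρ γ :=
  fun i j => hM (ρ i) (γ j)

theorem det [Fintype m] [DecidableEq m] {M : X → Matrix m m k} (hM : IsRationalFamily A M) :
    (fun x => (M x).det) ∈ piecewiseRational A := by
  convert (piecewiseRational A).sum_mem fun (σ : Equiv.Perm m) (_ : σ ∈ Finset.univ) =>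
    zsmul_mem ((piecewiseRational A).prod_mem fun i (_ : i ∈ Finset.univ) => hM (σ i) i)
      (Equiv.Perm.sign σ : ℤ)
  simp [Matrix.det_apply, Units.smul_def]

/-- Cramer's formula. It needs no invertibility: where the determinant vanishes, both the matrix
inverse and the inverse of the determinant are zero by convention. -/
theorem inv [Fintype m] [DecidableEq m] {M : X → Matrix m m k} (hM : IsRationalFamily A M) :
    IsRationalFamily A fun x => (M x)⁻¹ := by
  intro i j
  have h1 : (fun x => (M x).adjugate i j) ∈ piecewiseRational A := by
    simp_rw [Matrix.adjugate_apply]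
    refine det fun a b => ?_
    by_cases h : a = j
    · subst h
      simp only [Matrix.updateRow_self]
      exact (piecewiseRational A).algebraMap_mem _
    · simp only [Matrix.updateRow_ne h]
      exact hM a b
  convert (piecewiseRational A).mul_mem (IsPiecewiseRational.inv hM.det) h1 using 1
  ext x
  simp [Matrix.inv_def]

theorem isPiecewiseConstant_eq [Finite m] [Finite n] {M N : X → Matrix m n k}
    (hM : IsRationalFamily A M) (hN : IsRationalFamily A N) :
    IsPiecewiseConstant A fun x => M x = N x := by
  have := (IsPiecewiseConstant.pi fun i => IsPiecewiseConstant.pi fun j =>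
    ((hM.sub hN) i j).isPiecewiseConstant_eq_zero).comp fun c => ∀ i j, c i j
  convert this using 3 with x
  simp [← Matrix.ext_iff, sub_eq_zero]

/-- In the skeleton decomposition, the chosen columns are `M` times a selection matrix and the
chosen rows are a selection matrix times `M`. So the inverse minor, padded by selection matrices, is
a generalized inverse. There are finitely many candidates, and each one works on a union of strata.
-/
theorem exists_generalizedInverse [Fintype m] [Fintype n] {M : X → Matrix m n k}
    (hM : IsRationalFamily A M) :
    ∃ N : X → Matrix n m k, IsRationalFamily A N ∧ ∀ x, M x * N x * M x = M x := by
  classical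
  let ι := Σ r : Fin (Fintype.card n + 1), (Fin r → m) × (Fin r → n)
  let N : ι → X → Matrix n m k := fun i x =>
    (1 : Matrix n n k).submatrix id i.2.2 * ((M x).submatrix i.2.1 i.2.2)⁻¹ *
      (1 : Matrix m m k).submatrix i.2.1 id
  have hN : ∀ i, IsRationalFamily A (N i) := fun i =>
    ((const _).mul (hM.submatrix _ _).inv).mul (const _)
  obtain ⟨s, hs, hsN⟩ := IsPiecewiseConstant.exists_select (A := A)
    (S := fun i x => M x * N i x * M x = M x)
    (fun i => ((hM.mul (hN i)).mul hM).isPiecewiseConstant_eq hM) (fun x => by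
      obtain ⟨r, ρ, γ, hr, -, h⟩ := (M x).exists_eq_submatrix_mul
      refine ⟨⟨⟨r, by omega⟩, ρ, γ⟩, ?_⟩
      conv_rhs => rw [← h]
      have h1 : M x * (1 : Matrix n n k).submatrix id γ = (M x).submatrix id γ :=
        (congrArg (fun N : Matrix m n k => N.submatrix id γ) (Matrix.mul_one (M x)) :)
      have h2 : (1 : Matrix m m k).submatrix ρ id * M x = (M x).submatrix ρ id :=
        (congrArg (fun N : Matrix m n k => N.submatrix ρ id) (Matrix.one_mul (M x)) :)
      simp only [N]
      rw [← h1, ← h2]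
      simp only [Matrix.mul_assoc])
  exact ⟨fun x => N (s x) x, fun i j => IsPiecewiseRational.select hs fun a => hN a i j, hsN⟩

/-- Bases of the subquotients `ker (M x) / D (ker (N x))` which depend rationally on `x`. -/
theorem exists_basis_subquotient {p q n' : Type*} {n : Type v} [Fintype p] [Fintype q] [Fintype n]
    [Fintype n'] [DecidableEq n] [DecidableEq n'] {M : X → Matrix p n k} {N : X → Matrix q n' k}
    (hM : IsRationalFamily A M) (hN : IsRationalFamily A N) (D : Matrix n n' k)
    (hD : ∀ x v, N x *ᵥ v = 0 → M x *ᵥ D *ᵥ v = 0) :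
    ∃ (ι : Type v) (_ : Finite ι) (r : ι → ℕ) (s : X → ι)
      (U : ∀ i, X → Matrix n (Fin (r i)) k) (W : ∀ i, X → Matrix (Fin (r i)) n k),
      IsPiecewiseConstant A s ∧ (∀ i, IsRationalFamily A (U i)) ∧
      (∀ i, IsRationalFamily A (W i)) ∧ ∀ x, M x * U (s x) x = 0 ∧ W (s x) x * U (s x) x = 1 ∧
        (∀ v, N x *ᵥ v = 0 → W (s x) x *ᵥ D *ᵥ v = 0) ∧
        ∀ w, M x *ᵥ w = 0 →
          ∃ v, N x *ᵥ v = 0 ∧ w = U (s x) x *ᵥ W (s x) x *ᵥ w + D *ᵥ v := by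
  obtain ⟨M', hM', hMM⟩ := hM.exists_generalizedInverse
  obtain ⟨N', hN', hNN⟩ := hN.exists_generalizedInverse
  -- `P` and `P'` are projections onto `ker M` and `ker N`.
  let P : X → Matrix n n k := fun x => 1 - M' x * M x
  let P' : X → Matrix n' n' k := fun x => 1 - N' x * N x
  have hP : IsRationalFamily A P := (const 1).sub (hM'.mul hM)
  have hP' : IsRationalFamily A P' := (const 1).sub (hN'.mul hN)
  have hDP : IsRationalFamily A (fun x => D * P' x) := (const D).mul hP'
  obtain ⟨R, hR, hRR⟩ := hDP.exists_generalizedInverse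
  -- `D P'` has image `D (ker N)`, so `Q` is a projection onto `D (ker N)`.
  let Q : X → Matrix n n k := fun x => D * P' x * R x
  have hQ : IsRationalFamily A Q := hDP.mul hR
  -- `E` is idempotent, and its image is a complement of `D (ker N)` in `ker M`, thus a model of the
  -- subquotient.
  let E : X → Matrix n n k := fun x => (1 - Q x) * P x
  have hE : IsRationalFamily A E := ((const 1).sub hQ).mul hP
  have hNP : ∀ x, N x * P' x = 0 := fun x => by
    simp only [P', Matrix.mul_sub, Matrix.mul_one, ← Matrix.mul_assoc, hNN, sub_self]
  have hMP : ∀ x, M x * P x = 0 := fun x => by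
    simp only [P, Matrix.mul_sub, Matrix.mul_one, ← Matrix.mul_assoc, hMM, sub_self]
  have hPv : ∀ x w, M x *ᵥ w = 0 → P x *ᵥ w = w := fun x w hw => by
    simp only [P, sub_mulVec, one_mulVec, ← mulVec_mulVec, hw, mulVec_zero, sub_zero]
  have hPv' : ∀ x w, N x *ᵥ w = 0 → P' x *ᵥ w = w := fun x w hw => by
    simp only [P', sub_mulVec, one_mulVec, ← mulVec_mulVec, hw, mulVec_zero, sub_zero]
  have hMQ : ∀ x w, M x *ᵥ Q x *ᵥ w = 0 := fun x w => by
    have := hD x (P' x *ᵥ R x *ᵥ w) (by rw [mulVec_mulVec, hNP, zero_mulVec])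
    simpa only [Q, ← mulVec_mulVec] using this
  have hQD : ∀ x v, N x *ᵥ v = 0 → Q x *ᵥ D *ᵥ v = D *ᵥ v := fun x v hv => by
    rw [← hPv' x v hv, mulVec_mulVec _ D, mulVec_mulVec, hRR]
  have hEM : ∀ x w, M x *ᵥ E x *ᵥ w = 0 := fun x w => by
    simp only [E, ← mulVec_mulVec, sub_mulVec, one_mulVec, mulVec_sub, hMQ, sub_zero]
    rw [mulVec_mulVec, hMP, zero_mulVec]
  have hED : ∀ x v, N x *ᵥ v = 0 → E x *ᵥ D *ᵥ v = 0 := fun x v hv => by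
    simp only [E, ← mulVec_mulVec]
    rw [hPv x _ (hD x v hv), sub_mulVec, one_mulVec, hQD x v hv, sub_self]
  have hME : ∀ x, M x * E x = 0 := fun x =>
    ext_of_mulVec_single fun i => by rw [← mulVec_mulVec, hEM, zero_mulVec]
  have hQQ : ∀ x, Q x * Q x = Q x := fun x => by
    simp only [Q]
    rw [← Matrix.mul_assoc, hRR]
  have hEE : ∀ x, E x * E x = E x := fun x => by
    have h1 : P x * E x = E x := by
      rw [Matrix.sub_mul, Matrix.mul_assoc, hME, Matrix.mul_zero, Matrix.one_mul, sub_zero]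
    calc E x * E x = (1 - Q x) * (P x * E x) := Matrix.mul_assoc _ _ _
      _ = (1 - Q x) * (1 - Q x) * P x := by rw [h1, Matrix.mul_assoc]
      _ = E x := by simp [E, Matrix.mul_sub, Matrix.sub_mul, hQQ]
  -- The skeleton decomposition factors `E` as `U W`: the columns of `U` form a basis of the image,
  -- and `W` gives coordinates in it. Idempotency of `E` yields `W U = 1`.
  let ι := Σ r : Fin (Fintype.card n + 1), (Fin r → n) × (Fin r → n)
  let U : ∀ i : ι, X → Matrix n (Fin i.1) k := fun i x => (E x).submatrix id i.2.2
  let W : ∀ i : ι, X → Matrix (Fin i.1) n k := fun i x =>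
    ((E x).submatrix i.2.1 i.2.2)⁻¹ * (E x).submatrix i.2.1 id
  have hU : ∀ i, IsRationalFamily A (U i) := fun i => hE.submatrix _ _
  have hW : ∀ i, IsRationalFamily A (W i) := fun i => (hE.submatrix _ _).inv.mul (hE.submatrix _ _)
  obtain ⟨s, hs, hsUW⟩ := IsPiecewiseConstant.exists_select (A := A)
    (S := fun i x => U i x * W i x = E x ∧ W i x * U i x = 1)
    (fun i => (((hU i).mul (hW i)).isPiecewiseConstant_eq hE).and
      (((hW i).mul (hU i)).isPiecewiseConstant_eq (const 1)))
    (fun x => by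
      obtain ⟨r, ρ, γ, hr, hu, h⟩ := (E x).exists_eq_submatrix_mul
      refine ⟨⟨⟨r, by omega⟩, ρ, γ⟩, ?_, ?_⟩
      · simp only [U, W]
        rw [← Matrix.mul_assoc, h]
      · have h1 : (E x).submatrix ρ id * (E x).submatrix id γ = (E x).submatrix ρ γ :=
          (congrArg (fun N : Matrix n n k => N.submatrix ρ γ) (hEE x) :)
        simp only [U, W]
        rw [Matrix.mul_assoc, h1, Matrix.nonsing_inv_mul _ hu])
  refine ⟨ι, inferInstance, fun i => i.1, s, U, W, hs, hU, hW, fun x => ?_⟩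
  obtain ⟨h1, h2⟩ := hsUW x
  have hUE : E x * U (s x) x = U (s x) x := by
    rw [← h1, Matrix.mul_assoc, h2, Matrix.mul_one]
  have hWE : W (s x) x * E x = W (s x) x := by
    rw [← h1, ← Matrix.mul_assoc, h2, Matrix.one_mul]
  refine ⟨?_, h2, fun v hv => ?_, fun w hw => ⟨P' x *ᵥ R x *ᵥ w, ?_, ?_⟩⟩
  · rw [← hUE, ← Matrix.mul_assoc, hME, Matrix.zero_mul]
  · rw [← hWE, ← mulVec_mulVec, hED x v hv, mulVec_zero]
  · rw [mulVec_mulVec, hNP, zero_mulVec]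
  · rw [mulVec_mulVec w, h1]
    have h3 : E x *ᵥ w = w - Q x *ᵥ w := by
      simp only [E, ← mulVec_mulVec, hPv x w hw, sub_mulVec, one_mulVec]
    rw [h3]
    simp [Q, ← mulVec_mulVec]

end IsRationalFamily

end

end Families

/-! ## Triangles in the stable category -/

namespace FrobeniusStructure

section Exact

variable {E : Type u} [Category.{v} E] [Preadditive E] {F : FrobeniusStructure E}

theorem conflation_lift {S : ShortComplex E} (hS : F.IsConflation S) {Z : E} (h : Z ⟶ S.X₂)
    (w : h ≫ S.g = 0) : ∃ g : Z ⟶ S.X₁, g ≫ S.f = h := by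
  obtain ⟨hc⟩ := F.isKernel hS
  exact ⟨hc.lift (KernelFork.ofι h w), hc.fac _ WalkingParallelPair.zero⟩

theorem conflation_mono {S : ShortComplex E} (hS : F.IsConflation S) : Mono S.f := by
  obtain ⟨hc⟩ := F.isKernel hS
  exact ⟨fun _ _ h => Fork.IsLimit.hom_ext hc h⟩

/-- A conflation mapping to `A → IA → ΣA` by the identity of `A` is a pull-back of it. -/
theorem exists_lift_of_induces {S : ShortComplex E} (hS : F.IsConflation S)
    {e : S.X₃ ⟶ F.cosyz S.X₁} {h : S.X₂ ⟶ F.hull S.X₁} (h₁ : S.f ≫ h = F.hullι S.X₁)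
    (h₂ : S.g ≫ e = h ≫ F.hullπ S.X₁) {T : E} (x : T ⟶ S.X₃) (u : T ⟶ F.hull S.X₁)
    (w : x ≫ e = u ≫ F.hullπ S.X₁) : ∃ y : T ⟶ S.X₂, y ≫ S.g = x ∧ y ≫ h = u := by
  -- The lift is built on a projective `P` with a deflation onto `T`: there `x` lifts along `S.g`,
  -- and `r` corrects the component in the hull. The corrected lift vanishes on the kernel `N`, so
  -- it descends to `T`.
  obtain ⟨N, P, j, p, jp, hP, hproj⟩ := F.enough_proj T
  have : Epi p := F.conflation_epi hP
  have : Mono (F.hullι S.X₁) := conflation_mono (F.hull_conflation S.X₁)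
  obtain ⟨z, hz⟩ := hproj S hS (p ≫ x)
  obtain ⟨r, hr⟩ := conflation_lift (F.hull_conflation S.X₁) (z ≫ h - p ≫ u) (by
    simp only [Preadditive.sub_comp, Category.assoc, ← h₂, ← w]
    rw [← Category.assoc, hz, Category.assoc, sub_self])
  dsimp at r hr
  have hg : (z - r ≫ S.f) ≫ S.g = p ≫ x := by simp [hz]
  have hh : (z - r ≫ S.f) ≫ h = p ≫ u := by simp [h₁, hr]
  obtain ⟨s, hs⟩ := conflation_lift hS (j ≫ (z - r ≫ S.f)) (by
    rw [Category.assoc, hg, ← Category.assoc, jp, zero_comp])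
  have hs0 : s = 0 := by
    rw [← cancel_mono (F.hullι S.X₁), ← h₁, ← Category.assoc, hs, Category.assoc, hh,
      ← Category.assoc, jp, zero_comp, zero_comp]
  obtain ⟨y, hy⟩ := F.conflation_desc hP (z - r ≫ S.f) (by rw [← hs, hs0, zero_comp])
  dsimp at y hy
  refine ⟨y, ?_, ?_⟩
  · rw [← cancel_epi p, ← Category.assoc, hy, hg]
  · rw [← cancel_epi p, ← Category.assoc, hy, hh]

theorem hom_ext_of_induces {S : ShortComplex E} (hS : F.IsConflation S)
    {h : S.X₂ ⟶ F.hull S.X₁} (h₁ : S.f ≫ h = F.hullι S.X₁) {T : E} {y y' : T ⟶ S.X₂}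
    (hg : y ≫ S.g = y' ≫ S.g) (hh : y ≫ h = y' ≫ h) : y = y' := by
  have : Mono (F.hullι S.X₁) := conflation_mono (F.hull_conflation S.X₁)
  obtain ⟨r, hr⟩ := conflation_lift hS (y - y') (by simp [hg])
  have hr0 : r = 0 := by
    rw [← cancel_mono (F.hullι S.X₁), ← h₁, ← Category.assoc, hr]
    simp [hh]
  rw [← sub_eq_zero, ← hr, hr0, zero_comp]

/-- The third morphism of a standard triangle. -/
def connecting {A C : E} (e : C ⟶ F.cosyz A) : F.proj.obj C ⟶ F.susp.obj (F.proj.obj A) :=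
  F.proj.map e

/-- The standard triangle obtained by pulling back `M → IM → ΣM`. -/
theorem exists_isTriangle_pullback {M L : E} (ε : L ⟶ F.cosyz M) :
    ∃ (Y : E) (h : Y ⟶ F.hull M) (p : Y ⟶ L) (i : M ⟶ Y), IsPullback h p (F.hullπ M) ε ∧
      i ≫ h = F.hullι M ∧ i ≫ p = 0 ∧
      F.IsTriangle (M := F.proj.obj M) (F.proj.map i) (F.proj.map p) (connecting ε) := by
  obtain ⟨Y, h, p, hpb, K, j, jp, hK⟩ := F.exists_pullback (F.hullπ M) ε
    ⟨M, F.hullι M, F.hull_zero M, F.hull_conflation M⟩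
  let i : M ⟶ Y := hpb.lift (F.hullι M) 0 (by rw [F.hull_zero, zero_comp])
  have hih : i ≫ h = F.hullι M := hpb.lift_fst _ _ _
  have hip : i ≫ p = 0 := hpb.lift_snd _ _ _
  have : Mono (F.hullι M) := conflation_mono (F.hull_conflation M)
  have : Mono j := conflation_mono hK
  -- The pull-back axiom provides a conflation with some kernel `K` of `p`; the universal properties
  -- identify `K` with `M`.
  obtain ⟨s, hs⟩ := conflation_lift hK i hip
  obtain ⟨r, hr⟩ := conflation_lift (F.hull_conflation M) (j ≫ h) (by
    dsimp
    rw [Category.assoc, hpb.w, ← Category.assoc, jp, zero_comp])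
  dsimp at s hs r hr
  have hri : r ≫ i = j := hpb.hom_ext (by rw [Category.assoc, hih, hr])
    (by rw [Category.assoc, hip, comp_zero, jp])
  let σ : M ≅ K :=
    { hom := s
      inv := r
      hom_inv_id := by
        rw [← cancel_mono (F.hullι M), Category.assoc, hr, ← Category.assoc, hs, hih,
          Category.id_comp]
      inv_hom_id := by rw [← cancel_mono j, Category.assoc, hs, hri, Category.id_comp] }
  have hS : F.IsConflation (ShortComplex.mk i p hip) :=
    F.of_iso (ShortComplex.isoMk (S₁ := ShortComplex.mk j p jp) (S₂ := ShortComplex.mk i p hip)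
      σ.symm (Iso.refl _) (Iso.refl _) (by simpa [σ] using hri) (by simp)) hK
  refine ⟨Y, h, p, i, hpb, hih, hip, ShortComplex.mk i p hip, ε, Iso.refl _, Iso.refl _,
    Iso.refl _, hS, ⟨h, by simpa using hih, hpb.w.symm⟩, by simp, by simp, ?_⟩
  change connecting ε ≫ F.susp.map (𝟙 (F.proj.obj M)) = 𝟙 (F.proj.obj L) ≫ connecting ε
  rw [CategoryTheory.Functor.map_id, Category.id_comp, Category.comp_id]

end Exact

/-! ### Exactness and morphisms of triangles -/

variable {E : Type u} [Category.{v} E] [Preadditive E] [HasFiniteBiproducts E]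
  {F : FrobeniusStructure E}

theorem proj_map_eq_zero_iff {X Y : E} (f : X ⟶ Y) :
    F.proj.map f = 0 ↔ ∃ (P : E) (a : X ⟶ P) (b : P ⟶ Y), F.IsProj P ∧ F.IsInj P ∧ f = a ≫ b := by
  rw [← F.proj.map_zero, CategoryTheory.Quotient.functor_map_eq_iff]
  simp [stableRel]

theorem proj_map_comp_zero {X P Y : E} (hP : F.IsInj P) (a : X ⟶ P) (b : P ⟶ Y) :
    F.proj.map (a ≫ b) = 0 :=
  (proj_map_eq_zero_iff _).2 ⟨P, a, b, (F.proj_iff_inj _).2 hP, hP, rfl⟩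

/-- A stably trivial morphism lifts through every deflation. -/
theorem exists_lift_of_proj_map_eq_zero {X : E} {S : ShortComplex E} (hS : F.IsConflation S)
    (f : X ⟶ S.X₃) (hf : F.proj.map f = 0) :
    ∃ t : X ⟶ S.X₂, F.proj.map t = 0 ∧ t ≫ S.g = f := by
  obtain ⟨P, a, b, hP, hI, rfl⟩ := (proj_map_eq_zero_iff f).1 hf
  obtain ⟨c, rfl⟩ := hP S hS b
  exact ⟨a ≫ c, proj_map_comp_zero hI _ _, Category.assoc _ _ _⟩

/-- A morphism from `X` to an injective extends along `X → IX`, so one injective serves for all. The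
stably trivial morphisms thus form the image of a single linear map. -/
theorem proj_map_eq_zero_iff_exists_hullι {X Y : E} (f : X ⟶ Y) :
    F.proj.map f = 0 ↔ ∃ w : F.hull X ⟶ Y, f = F.hullι X ≫ w := by
  constructor
  · intro hf
    obtain ⟨P, a, b, hP, hI, rfl⟩ := (proj_map_eq_zero_iff f).1 hf
    obtain ⟨c, hc⟩ := hI _ (F.hull_conflation X) a
    exact ⟨c ≫ b, by rw [← hc, Category.assoc]⟩
  · rintro ⟨w, rfl⟩
    exact proj_map_comp_zero (F.hull_inj X) _ _

/-- If `x ≫ S.g` is stably zero, subtracting a stably trivial lift of it from `x` makes the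
composite zero in `E`, and the difference factors through the kernel `S.f`. -/
theorem exact_standard₂ {S : ShortComplex E} (hS : F.IsConflation S) (T : F.Stable) :
    Function.Exact (fun x : T ⟶ F.proj.obj S.X₁ => x ≫ F.proj.map S.f)
      (fun x : T ⟶ F.proj.obj S.X₂ => x ≫ F.proj.map S.g) := by
  obtain ⟨T⟩ := T
  intro x
  constructor
  · intro hx
    obtain ⟨x, rfl⟩ := F.proj.map_surjective (X := T) x
    obtain ⟨t, ht, htx⟩ := exists_lift_of_proj_map_eq_zero hS (x ≫ S.g) (by
      rw [Functor.map_comp]; exact hx)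
    obtain ⟨y, hy⟩ := conflation_lift hS (x - t) (by simp [htx])
    refine ⟨F.proj.map y, ?_⟩
    beta_reduce
    rw [← Functor.map_comp, hy, Functor.map_sub, ht, sub_zero]
  · rintro ⟨y, rfl⟩
    beta_reduce
    rw [Category.assoc, ← Functor.map_comp, S.zero, Functor.map_zero, comp_zero]

/-- If `x ≫ e` is stably zero, it lifts to the hull of `S.X₁`; together with `x` this lift defines a
morphism into the pull-back `S.X₂`. -/
theorem exact_standard₃ {S : ShortComplex E} (hS : F.IsConflation S) {e : S.X₃ ⟶ F.cosyz S.X₁}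
    (he : F.Induces S (𝟙 S.X₁) e) (T : F.Stable) :
    Function.Exact (fun x : T ⟶ F.proj.obj S.X₂ => x ≫ F.proj.map S.g)
      (fun x : T ⟶ F.proj.obj S.X₃ => x ≫ connecting e) := by
  change Function.Exact _ fun x : T ⟶ F.proj.obj S.X₃ => x ≫ F.proj.map e
  obtain ⟨T⟩ := T
  obtain ⟨h, h₁, h₂⟩ := he
  rw [Category.id_comp] at h₁
  intro x
  constructor
  · intro hx
    obtain ⟨x, rfl⟩ := F.proj.map_surjective (X := T) x
    obtain ⟨t, -, htx⟩ := exists_lift_of_proj_map_eq_zero (F.hull_conflation S.X₁) (x ≫ e) (by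
      rw [Functor.map_comp]; exact hx)
    obtain ⟨y, hy, -⟩ := exists_lift_of_induces hS h₁ h₂ x t htx.symm
    refine ⟨F.proj.map y, ?_⟩
    beta_reduce
    rw [← Functor.map_comp, hy]
  · rintro ⟨y, rfl⟩
    beta_reduce
    rw [Category.assoc, ← Functor.map_comp, h₂, proj_map_comp_zero (F.hull_inj _), comp_zero]

namespace IsTriangle

variable {M Y L : F.Stable} {i : M ⟶ Y} {p : Y ⟶ L} {ε : L ⟶ F.susp.obj M}

theorem exact₂ (h : F.IsTriangle i p ε) (T : F.Stable) :
    Function.Exact (fun x : T ⟶ M => x ≫ i) (fun x : T ⟶ Y => x ≫ p) := by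
  obtain ⟨S, e, α, β, γ, hS, -, hi, hp, -⟩ := h
  have hex := exact_standard₂ hS T
  intro x
  have h1 : x ≫ p = 0 ↔ (x ≫ β.hom) ≫ F.proj.map S.g = 0 := by
    rw [Category.assoc, ← hp, ← Category.assoc,
      Preadditive.IsIso.comp_right_eq_zero (x ≫ p) γ.hom]
  refine (h1.trans (hex _)).trans ⟨?_, ?_⟩
  · rintro ⟨y, hy⟩
    refine ⟨y ≫ α.inv, ?_⟩
    beta_reduce at hy ⊢
    rw [← cancel_mono β.hom, ← hy, Category.assoc, hi]
    simp
  · rintro ⟨y, rfl⟩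
    exact ⟨y ≫ α.hom, by simp [hi]⟩

theorem exact₃ (h : F.IsTriangle i p ε) (T : F.Stable) :
    Function.Exact (fun x : T ⟶ Y => x ≫ p) (fun x : T ⟶ L => x ≫ ε) := by
  obtain ⟨S, e, α, β, γ, hS, he, -, hp, hε⟩ := h
  replace hε : ε ≫ F.susp.map α.hom = γ.hom ≫ connecting e := hε
  have hex := exact_standard₃ hS he T
  intro x
  have h1 : x ≫ ε = 0 ↔ (x ≫ γ.hom) ≫ connecting e = 0 := by
    rw [Category.assoc, ← hε, ← Category.assoc,
      Preadditive.IsIso.comp_right_eq_zero (x ≫ ε) (F.susp.map α.hom)]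
  refine (h1.trans (hex _)).trans ⟨?_, ?_⟩
  · rintro ⟨y, hy⟩
    refine ⟨y ≫ β.inv, ?_⟩
    beta_reduce at hy ⊢
    rw [← cancel_mono γ.hom, ← hy, Category.assoc, hp]
    simp
  · rintro ⟨y, rfl⟩
    exact ⟨y ≫ β.hom, by simp [hp]⟩

end IsTriangle

/-- Morphisms between the outer terms of two standard triangles extend to the middle terms. -/
theorem exists_map_standard {S S' : ShortComplex E} (hS' : F.IsConflation S')
    {e : S.X₃ ⟶ F.cosyz S.X₁} {e' : S'.X₃ ⟶ F.cosyz S'.X₁} (he : F.Induces S (𝟙 S.X₁) e)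
    (he' : F.Induces S' (𝟙 S'.X₁) e') (a : F.proj.obj S.X₁ ⟶ F.proj.obj S'.X₁)
    (c : F.proj.obj S.X₃ ⟶ F.proj.obj S'.X₃)
    (w : connecting e ≫ F.susp.map a = c ≫ connecting e') :
    ∃ b : F.proj.obj S.X₂ ⟶ F.proj.obj S'.X₂,
      F.proj.map S.f ≫ b = a ≫ F.proj.map S'.f ∧ b ≫ F.proj.map S'.g = F.proj.map S.g ≫ c := by
  obtain ⟨a, rfl⟩ := F.proj.map_surjective a
  obtain ⟨c, rfl⟩ := F.proj.map_surjective c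
  obtain ⟨h, h₁, h₂⟩ := he
  obtain ⟨h', h₁', h₂'⟩ := he'
  obtain ⟨l, l₁, l₂⟩ := F.suspMap_induces a
  dsimp at l l₁ l₂
  rw [Category.id_comp] at h₁ h₁'
  -- The square commutes only stably. Its defect lifts to a morphism `t` into the hull, and
  -- subtracting `S.g ≫ t` gives a pair compatible in `E`, hence a morphism into the pull-back
  -- `S'.X₂`.
  have hw : F.proj.map (e ≫ F.suspMap a - c ≫ e') = 0 := by
    rw [Functor.map_sub, Functor.map_comp, Functor.map_comp, sub_eq_zero]
    exact w
  obtain ⟨t, -, ht⟩ := exists_lift_of_proj_map_eq_zero (F.hull_conflation S'.X₁) _ hw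
  dsimp at t ht
  obtain ⟨b, hb, hb'⟩ := exists_lift_of_induces hS' h₁' h₂' (S.g ≫ c) (h ≫ l - S.g ≫ t) (by
    rw [Preadditive.sub_comp, Category.assoc, Category.assoc, Category.assoc, ht, ← l₂,
      ← Category.assoc h, ← h₂]
    simp)
  refine ⟨F.proj.map b, ?_, ?_⟩
  · rw [← Functor.map_comp, ← Functor.map_comp]
    congr 1
    refine hom_ext_of_induces hS' h₁' ?_ ?_
    · rw [Category.assoc, hb, Category.assoc, S'.zero, ← Category.assoc, S.zero, zero_comp,
        comp_zero]
    · rw [Category.assoc, hb', Preadditive.comp_sub, ← Category.assoc, h₁, ← Category.assoc,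
        S.zero, zero_comp, sub_zero, l₁, Category.assoc, h₁']
  · rw [← Functor.map_comp, hb, Functor.map_comp]

theorem IsTriangle.exists_map {M Y Y' L : F.Stable} {i : M ⟶ Y} {p : Y ⟶ L} {i' : M ⟶ Y'}
    {p' : Y' ⟶ L} {ε : L ⟶ F.susp.obj M} (h : F.IsTriangle i p ε) (h' : F.IsTriangle i' p' ε) :
    ∃ b : Y ⟶ Y', i ≫ b = i' ∧ b ≫ p' = p := by
  obtain ⟨S, e, α, β, γ, hS, he, hi, hp, hε⟩ := h
  obtain ⟨S', e', α', β', γ', hS', he', hi', hp', hε'⟩ := h'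
  replace hε : ε ≫ F.susp.map α.hom = γ.hom ≫ connecting e := hε
  replace hε' : ε ≫ F.susp.map α'.hom = γ'.hom ≫ connecting e' := hε'
  obtain ⟨b, hb, hb'⟩ := exists_map_standard hS' he he' (α.inv ≫ α'.hom) (γ.inv ≫ γ'.hom) (by
    rw [← cancel_epi γ.hom, ← Category.assoc, ← hε, Category.assoc, ← Functor.map_comp,
      Category.assoc, Iso.hom_inv_id_assoc, Iso.hom_inv_id_assoc, hε'])
  refine ⟨β.hom ≫ b ≫ β'.inv, ?_, ?_⟩
  · rw [← cancel_mono β'.hom, ← Category.assoc, hi, Category.assoc, Category.assoc, Category.assoc,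
      Iso.inv_hom_id, Category.comp_id, hb, hi']
    simp
  · rw [← cancel_mono γ'.hom, Category.assoc, hp', Category.assoc, Category.assoc,
      Iso.inv_hom_id_assoc, hb', ← Category.assoc, ← hp]
    simp

/-- Half of the five lemma: `y' ≫ p'` is killed by `ε`, so it comes from some `y`, and `y' - y ≫ b`
comes from `M`, where `i' = i ≫ b`. -/
theorem IsTriangle.surjective_of_map {M Y Y' L : F.Stable} {i : M ⟶ Y} {p : Y ⟶ L} {i' : M ⟶ Y'}
    {p' : Y' ⟶ L} {ε : L ⟶ F.susp.obj M} (h : F.IsTriangle i p ε) (h' : F.IsTriangle i' p' ε)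
    {b : Y ⟶ Y'} (hi : i ≫ b = i') (hp : b ≫ p' = p) (T : F.Stable) :
    Function.Surjective fun y : T ⟶ Y => y ≫ b := by
  intro y'
  obtain ⟨y, hy⟩ := (h.exact₃ T (y' ≫ p')).1 ((h'.exact₃ T _).2 ⟨y', rfl⟩)
  beta_reduce at hy
  obtain ⟨m, hm⟩ := (h'.exact₂ T (y' - y ≫ b)).1 (by
    beta_reduce
    rw [Preadditive.sub_comp, Category.assoc, hp, hy, sub_self])
  beta_reduce at hm
  refine ⟨y + m ≫ i, ?_⟩
  beta_reduce
  rw [Preadditive.add_comp, Category.assoc, hi, hm, add_sub_cancel]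

end FrobeniusStructure

/-! ## Matrix representations obtained from bases -/

section

variable {k : Type*} [Field k] {C : Type*} [Category C] [Preadditive C] [Linear k C]

variable (k) in
/-- The action of `End T` on `Hom(T, X)` by precomposition. -/
def precompAlgHom (T X : C) : (End T)ᵐᵒᵖ →ₐ[k] Module.End k (T ⟶ X) :=
  AlgHom.ofLinearMap
    { toFun := fun b => Linear.leftComp k X (show T ⟶ T from b.unop)
      map_add' := fun _ _ => LinearMap.ext fun _ => Preadditive.add_comp _ _ _ _ _ _
      map_smul' := fun _ _ => LinearMap.ext fun _ => Linear.smul_comp _ _ _ _ _ _ }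
    (LinearMap.ext fun _ => Category.id_comp _)
    (fun _ _ => LinearMap.ext fun _ => Category.assoc _ _ _)

/-- Transport of structure along bases; the explicit entries are what rationality is checked on. -/
theorem exists_matRep_of_linearEquiv {Q : Type*} [Quiver Q] (T : C) (D : Q ⥤q C) (d : Q → ℕ)
    (e : ∀ q, (T ⟶ D.obj q) ≃ₗ[k] (Fin (d q) → k)) :
    ∃ ρ : MatRep k (End T) Q d, ρ ∈ homOrbit k T D d ∧
      (∀ q (b : (End T)ᵐᵒᵖ) r s, ρ.act q b r s =
        e q ((show T ⟶ T from b.unop) ≫ (e q).symm (Pi.single s 1)) r) ∧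
      ∀ (q q' : Q) (a : q ⟶ q') r s, ρ.map a r s =
        e q' ((e q).symm (Pi.single s 1) ≫ D.map a) r := by
  let act : ∀ q, (End T)ᵐᵒᵖ →ₐ[k] Matrix (Fin (d q)) (Fin (d q)) k := fun q =>
    (LinearMap.toMatrixAlgEquiv' : _ ≃ₐ[k] Matrix (Fin (d q)) (Fin (d q)) k).toAlgHom.comp
      (((e q).conjAlgEquiv k).toAlgHom.comp (precompAlgHom k T (D.obj q)))
  let map : ∀ {q q' : Q}, (q ⟶ q') → Matrix (Fin (d q')) (Fin (d q)) k := fun {q q'} a =>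
    LinearMap.toMatrix' ((e q').toLinearMap ∘ₗ Linear.rightComp k T (D.map a) ∘ₗ
      (e q).symm.toLinearMap)
  have hact : ∀ q (b : (End T)ᵐᵒᵖ) v, (act q b).mulVec v =
      e q ((show T ⟶ T from b.unop) ≫ (e q).symm v) := fun q b v =>
    LinearMap.toMatrix'_mulVec ((e q).conjAlgEquiv k (precompAlgHom k T (D.obj q) b)) v
  have hmap : ∀ (q q' : Q) (a : q ⟶ q') v, (map a).mulVec v =
      e q' ((e q).symm v ≫ D.map a) := fun q q' a v => LinearMap.toMatrix'_mulVec _ v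
  have hmapact : ∀ {q q' : Q} (a : q ⟶ q') (b : (End T)ᵐᵒᵖ),
      map a * act q b = act q' b * map a := fun {q q'} a b =>
    Matrix.ext_of_mulVec_single fun s => by
      rw [← Matrix.mulVec_mulVec, ← Matrix.mulVec_mulVec, hact, hmap, hact, hmap]
      simp
  refine ⟨⟨act, map, hmapact⟩, ⟨e, fun q b x => ?_, fun q q' a x => ?_⟩, fun q b r s => ?_,
    fun q q' a r s => ?_⟩
  · rw [hact]; simp
  · rw [hmap]; simp
  · rw [← hact, Matrix.mulVec_single_one]; rfl
  · rw [← hmap, Matrix.mulVec_single_one]; rfl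

theorem homOrbit_of_linearEquiv {Q : Type*} [Quiver Q] (T : C) (D D' : Q ⥤q C) (d : Q → ℕ)
    (f : ∀ q, (T ⟶ D'.obj q) ≃ₗ[k] (T ⟶ D.obj q))
    (hf : ∀ q (b : End T) x, f q ((show T ⟶ T from b) ≫ x) = (show T ⟶ T from b) ≫ f q x)
    (hf' : ∀ (q q' : Q) (a : q ⟶ q') x, f q' (x ≫ D'.map a) = f q x ≫ D.map a) :
    homOrbit k T D d ⊆ homOrbit k T D' d := by
  rintro ρ ⟨e, h, h'⟩
  exact ⟨fun q => f q ≪≫ₗ e q, fun q b x => by simp [hf, h], fun q q' a x => by simp [hf', h']⟩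

end

namespace MatRep

variable (k : Type*) [Field k] (B : Type*) [Ring B] [Algebra k B] (Q : Type*) [Quiver Q]

/-- The generators of the coordinate ring: the entries of the matrices. -/
def entries (d : Q → ℕ) : Set (MatRep k B Q d → k) :=
  {f | ∃ (i : Q) (b : Bᵐᵒᵖ) (r s : Fin (d i)), f = fun R => R.act i b r s} ∪
    {f | ∃ (i j : Q) (a : i ⟶ j) (r : Fin (d j)) (s : Fin (d i)), f = fun R => R.map a r s}

/-- The entries of the action are linear in the algebra element, so a finite spanning set of `Bᵐᵒᵖ`
suffices. -/
theorem exists_finite_entries [Module.Finite k B] [Finite Q] [∀ i j : Q, Finite (i ⟶ j)]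
    (d : Q → ℕ) :
    ∃ G ⊆ entries k B Q d, G.Finite ∧ coordinateRing k B Q d = Algebra.adjoin k G := by
  have : Module.Finite k Bᵐᵒᵖ := Module.Finite.equiv (MulOpposite.opLinearEquiv k)
  obtain ⟨S, hS⟩ := Module.Finite.fg_top (R := k) (M := Bᵐᵒᵖ)
  let g₁ : (Σ i : Q, S × Fin (d i) × Fin (d i)) → MatRep k B Q d → k :=
    fun x R => R.act x.1 x.2.1 x.2.2.1 x.2.2.2
  let g₂ : (Σ (i : Q) (j : Q), (i ⟶ j) × Fin (d j) × Fin (d i)) → MatRep k B Q d → k :=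
    fun x R => R.map x.2.2.1 x.2.2.2.1 x.2.2.2.2
  have hsub : Set.range g₁ ∪ Set.range g₂ ⊆ entries k B Q d := by
    rintro _ (⟨⟨i, b, r, s⟩, rfl⟩ | ⟨⟨i, j, a, r, s⟩, rfl⟩)
    exacts [Or.inl ⟨i, b, r, s, rfl⟩, Or.inr ⟨i, j, a, r, s, rfl⟩]
  refine ⟨_, hsub, (Set.finite_range _).union (Set.finite_range _),
    le_antisymm (Algebra.adjoin_le ?_) (Algebra.adjoin_mono hsub)⟩
  rintro _ (⟨i, b, r, s, rfl⟩ | ⟨i, j, a, r, s, rfl⟩)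
  · have hb : b ∈ Submodule.span k (S : Set Bᵐᵒᵖ) := hS ▸ Submodule.mem_top
    induction hb using Submodule.span_induction with
    | mem b hb => exact Algebra.subset_adjoin (Or.inl ⟨⟨i, ⟨b, hb⟩, r, s⟩, rfl⟩)
    | zero =>
      simp only [map_zero, Matrix.zero_apply]
      exact Subalgebra.zero_mem _
    | add b b' _ _ h h' =>
      simp only [map_add, Matrix.add_apply]
      exact Subalgebra.add_mem _ h h'
    | smul c b _ h =>
      simp only [map_smul, Matrix.smul_apply]
      exact Subalgebra.smul_mem _ h c
  · exact Algebra.subset_adjoin (Or.inr ⟨⟨i, j, a, r, s⟩, rfl⟩)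

end MatRep

instance : Finite QuiverA4 :=
  Finite.of_injective (β := Fin 4) (fun | .v1 => 0 | .v2 => 1 | .v3 => 2 | .v4 => 3)
    (by rintro (_ | _ | _ | _) (_ | _ | _ | _) h <;> first | rfl | simp at h)

instance (i j : QuiverA4) : Finite (i ⟶ j) :=
  have : Subsingleton (i ⟶ j) := ⟨by rintro (_ | _ | _) (_ | _ | _) <;> rfl⟩
  Finite.of_subsingleton

/-- Linear maps with the same kernel are related by an isomorphism of their images. -/
theorem LinearMap.exists_linearEquiv_of_ker_eq {k V N P : Type*} [Ring k] [AddCommGroup V]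
    [AddCommGroup N] [AddCommGroup P] [Module k V] [Module k N] [Module k P] (q : V →ₗ[k] N)
    (g : V →ₗ[k] P) (hq : Function.Surjective q) (hg : Function.Surjective g)
    (h : ∀ v, q v = 0 ↔ g v = 0) : ∃ e : N ≃ₗ[k] P, ∀ v, e (q v) = g v := by
  refine ⟨(q.quotKerEquivOfSurjective hq).symm ≪≫ₗ
    Submodule.quotEquivOfEq _ _ (Submodule.ext (p := q.ker) (q := g.ker) h) ≪≫ₗ g.quotKerEquivOfSurjective hg, fun v => ?_⟩
  have : (q.quotKerEquivOfSurjective hq).symm (q v) = Submodule.Quotient.mk v :=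
    (LinearEquiv.symm_apply_eq _).2 rfl
  simp only [LinearEquiv.trans_apply, this]
  rfl

/-! ## Middle terms of triangles -/

namespace FrobeniusStructure

open Matrix

variable {k : Type*} [Field k] {E : Type u} [Category.{v} E] [Preadditive E] [Linear k E]
  {F : FrobeniusStructure E}

variable (k F) in
/-- The map whose kernel is the space of morphisms from `X` to the pull-back of `M → IM → ΣM`
along `ε`. -/
def pairMap (M L X : E) (ε : L ⟶ F.cosyz M) :
    ((X ⟶ F.hull M) × (X ⟶ L)) →ₗ[k] (X ⟶ F.cosyz M) :=
  Linear.rightComp k X (F.hullπ M) ∘ₗ LinearMap.fst k _ _ -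
    Linear.rightComp k X ε ∘ₗ LinearMap.snd k _ _

theorem pairMap_apply (M L X : E) (ε : L ⟶ F.cosyz M) (w : (X ⟶ F.hull M) × (X ⟶ L)) :
    pairMap k F M L X ε w = w.1 ≫ F.hullπ M - w.2 ≫ ε := rfl

variable (k F) in
/-- Precomposition on pairs of morphisms. -/
def pairPrecomp (M L : E) {X X' : E} (f : X' ⟶ X) :
    ((X ⟶ F.hull M) × (X ⟶ L)) →ₗ[k] ((X' ⟶ F.hull M) × (X' ⟶ L)) :=
  (Linear.leftComp k (F.hull M) f).prodMap (Linear.leftComp k L f)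

theorem pairPrecomp_apply (M L : E) {X X' : E} (f : X' ⟶ X) (w : (X ⟶ F.hull M) × (X ⟶ L)) :
    pairPrecomp k F M L f w = (f ≫ w.1, f ≫ w.2) := rfl

theorem affine_mem_affineSpaceRing {V : Type*} [AddCommGroup V] [Module k V]
    (l : Module.Dual k V) (c : k) : (fun v => c - l v) ∈ affineSpaceRing k V :=
  Subalgebra.sub_mem _ (Subalgebra.algebraMap_mem _ c) (Algebra.subset_adjoin ⟨l, rfl⟩)

/-- The entries are affine in `ε`: the hull component contributes a constant, the other component a
linear form. -/
theorem isRationalFamily_pairMap {V : Type*} [AddCommGroup V] [Module k V] {M L X : E}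
    (σ : V →ₗ[k] (L ⟶ F.cosyz M)) {n p : Type*} [Fintype n] [Finite p] [DecidableEq n]
    (b : Module.Basis n k ((X ⟶ F.hull M) × (X ⟶ L))) (b' : Module.Basis p k (X ⟶ F.cosyz M)) :
    IsRationalFamily (affineSpaceRing k V)
      fun ε => LinearMap.toMatrix b b' (pairMap k F M L X (σ ε)) := fun i j => by
  refine IsPiecewiseRational.of_mem ?_
  convert affine_mem_affineSpaceRing
    (b'.coord i ∘ₗ Linear.leftComp k (F.cosyz M) (b j).2 ∘ₗ σ)
    (b'.coord i ((b j).1 ≫ F.hullπ M)) using 2 with ε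
  beta_reduce
  rw [LinearMap.toMatrix_apply, pairMap_apply, map_sub]
  rfl

variable [HasFiniteBiproducts E]

instance linear_proj : F.proj.Linear k :=
  CategoryTheory.Quotient.linear_functor k F.stableRel _

theorem finite_stable_hom (hfin : ∀ X Y : E, Module.Finite k (X ⟶ Y)) (X Y : F.Stable) :
    Module.Finite k (X ⟶ Y) :=
  have := hfin X.as Y.as
  Module.Finite.of_surjective (F.proj.mapLinearMap k (X := X.as) (Y := Y.as))
    F.proj.map_surjective

variable (k) in
/-- Third morphisms of standard triangles, as a linear map. -/
def connectingₗ (F : FrobeniusStructure E) (C A : E) :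
    (C ⟶ F.cosyz A) →ₗ[k] (F.proj.obj C ⟶ F.susp.obj (F.proj.obj A)) :=
  F.proj.mapLinearMap k

theorem connectingₗ_surjective (C A : E) : Function.Surjective (F.connectingₗ k C A) :=
  F.proj.map_surjective

/-! ### Independence of the chosen triangle -/

theorem IsTriangle.finrank_le [∀ X Y : F.Stable, Module.Finite k (X ⟶ Y)]
    {M Y L : F.Stable} {i : M ⟶ Y} {p : Y ⟶ L}
    {ε : L ⟶ F.susp.obj M} (h : F.IsTriangle i p ε) (T : F.Stable) :
    Module.finrank k (T ⟶ Y) ≤ Module.finrank k (T ⟶ M) + Module.finrank k (T ⟶ L) := by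
  have h1 := (Linear.rightComp k T p).finrank_range_add_finrank_ker
  have h2 : (Linear.rightComp k T p).ker = (Linear.rightComp k T i).range :=
    LinearMap.exact_iff.1 (h.exact₂ T)
  rw [h2] at h1
  have h3 := (Linear.rightComp k T i).finrank_range_le
  have h4 := (Linear.rightComp k T p).range.finrank_le
  omega

/-- Comparison morphisms exist in both directions and are surjective on `Hom(T, -)`. Equality of
dimensions makes them bijective there, and postcomposition commutes with the action of `End T`. -/
theorem IsTriangle.homOrbit_subset [∀ X Y : F.Stable, Module.Finite k (X ⟶ Y)]
    {M Y Y' L : F.Stable} {i : M ⟶ Y} {p : Y ⟶ L} {i' : M ⟶ Y'}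
    {p' : Y' ⟶ L} {ε : L ⟶ F.susp.obj M} (h : F.IsTriangle i p ε) (h' : F.IsTriangle i' p' ε)
    (T : F.Stable) (d : QuiverA4 → ℕ) :
    homOrbit k T (QuiverA4.diagram i p ε) d ⊆ homOrbit k T (QuiverA4.diagram i' p' ε) d := by
  obtain ⟨b, hi, hp⟩ := h'.exists_map h
  obtain ⟨c, hi', hp'⟩ := h.exists_map h'
  have hb := h'.surjective_of_map h hi hp T
  have hc := h.surjective_of_map h' hi' hp' T
  have hle := LinearMap.finrank_le_finrank_of_surjective (f := Linear.rightComp k T b) hb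
  have hle' := LinearMap.finrank_le_finrank_of_surjective (f := Linear.rightComp k T c) hc
  have hinj := (LinearMap.injective_iff_surjective_of_finrank_eq_finrank
    (f := Linear.rightComp k T b) (le_antisymm hle' hle)).2 hb
  let f : (T ⟶ Y') ≃ₗ[k] (T ⟶ Y) := LinearEquiv.ofBijective (Linear.rightComp k T b) ⟨hinj, hb⟩
  refine homOrbit_of_linearEquiv T _ _ d
    (fun
      | .v1 => LinearEquiv.refl k _
      | .v2 => f
      | .v3 => LinearEquiv.refl k _
      | .v4 => LinearEquiv.refl k _) ?_ ?_
  · have hassoc : ∀ (β : T ⟶ T) (x : T ⟶ Y'), (β ≫ x) ≫ b = β ≫ x ≫ b := fun β x =>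
      Category.assoc _ _ _
    rintro (_ | _ | _ | _) β x
    exacts [rfl, hassoc β x, rfl, rfl]
  · have h₁ : ∀ x : T ⟶ M, (x ≫ i') ≫ b = x ≫ i := fun x => by rw [Category.assoc, hi]
    have h₂ : ∀ x : T ⟶ Y', x ≫ p' = (x ≫ b) ≫ p := fun x => by rw [Category.assoc, hp]
    rintro _ _ (_ | _ | _) x
    exacts [h₁ x, h₂ x, rfl]

/-! ### Coordinates on the middle terms -/

/-- The pull-back property identifies morphisms into `Y` with the kernel of `pairMap`, both from `T`
and from its hull. The projection to stable morphisms and the coordinate map given by `W` are then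
surjections with the same kernel: the morphisms factoring through `T → IT`. -/
theorem exists_linearEquiv_middle {T L M Y : E} {n : Type*} [Fintype n] {m : ℕ}
    (c : ((T ⟶ F.hull M) × (T ⟶ L)) ≃ₗ[k] (n → k)) {ε : L ⟶ F.cosyz M} {h : Y ⟶ F.hull M}
    {p : Y ⟶ L} (hpb : IsPullback h p (F.hullπ M) ε) (U : Matrix n (Fin m) k)
    (W : Matrix (Fin m) n k) (h₁ : ∀ v, pairMap k F M L T ε (c.symm (U *ᵥ v)) = 0)
    (h₂ : W * U = 1)
    (h₃ : ∀ w, pairMap k F M L (F.hull T) ε w = 0 →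
      W *ᵥ c (pairPrecomp k F M L (F.hullι T) w) = 0)
    (h₄ : ∀ w, pairMap k F M L T ε w = 0 → ∃ w', pairMap k F M L (F.hull T) ε w' = 0 ∧
      c w = U *ᵥ W *ᵥ c w + c (pairPrecomp k F M L (F.hullι T) w')) :
    ∃ e : (F.proj.obj T ⟶ F.proj.obj Y) ≃ₗ[k] (Fin m → k),
      (∀ y : T ⟶ Y, e (F.proj.map y) = W *ᵥ c (y ≫ h, y ≫ p)) ∧
      ∀ v, ∃ y : T ⟶ Y, e.symm v = F.proj.map y ∧ c (y ≫ h, y ≫ p) = U *ᵥ v := by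
  let κ : (T ⟶ Y) →ₗ[k] ((T ⟶ F.hull M) × (T ⟶ L)) :=
    (Linear.rightComp k T h).prod (Linear.rightComp k T p)
  have hκ : ∀ y, κ y = (y ≫ h, y ≫ p) := fun _ => rfl
  have hκ0 : ∀ {X : E} (y : X ⟶ Y), pairMap k F M L X ε (y ≫ h, y ≫ p) = 0 := fun y => by
    rw [pairMap_apply, Category.assoc, Category.assoc, hpb.w, sub_self]
  have hlift : ∀ {X : E} (w : (X ⟶ F.hull M) × (X ⟶ L)), pairMap k F M L X ε w = 0 →
      ∃ y : X ⟶ Y, (y ≫ h, y ≫ p) = w := fun w hw => by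
    rw [pairMap_apply, sub_eq_zero] at hw
    exact ⟨hpb.lift w.1 w.2 hw, Prod.ext (hpb.lift_fst _ _ _) (hpb.lift_snd _ _ _)⟩
  let g : (T ⟶ Y) →ₗ[k] (Fin m → k) := W.mulVecLin ∘ₗ c.toLinearMap ∘ₗ κ
  have hg : ∀ y, g y = W *ᵥ c (y ≫ h, y ≫ p) := fun _ => rfl
  have hU : ∀ v, ∃ y : T ⟶ Y, g y = v ∧ c (y ≫ h, y ≫ p) = U *ᵥ v := fun v => by
    obtain ⟨y, hy⟩ := hlift _ (h₁ v)
    refine ⟨y, ?_, ?_⟩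
    · rw [hg, hy, c.apply_symm_apply, mulVec_mulVec, h₂, one_mulVec]
    · rw [hy, c.apply_symm_apply]
  obtain ⟨e, he⟩ := (F.proj.mapLinearMap k (X := T) (Y := Y)).exists_linearEquiv_of_ker_eq g
    F.proj.map_surjective (fun v => ⟨_, (hU v).choose_spec.1⟩) (fun y => by
      change F.proj.map y = 0 ↔ _
      rw [proj_map_eq_zero_iff_exists_hullι]
      constructor
      · rintro ⟨w, rfl⟩
        rw [hg, ← h₃ _ (hκ0 w), pairPrecomp_apply, Category.assoc, Category.assoc]
      · intro hy
        obtain ⟨w', hw', hw⟩ := h₄ _ (hκ0 y)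
        rw [← hg, hy, mulVec_zero, zero_add] at hw
        obtain ⟨z, rfl⟩ := hlift w' hw'
        have := c.injective hw
        rw [pairPrecomp_apply, Prod.mk.injEq] at this
        exact ⟨z, hpb.hom_ext (by rw [this.1, Category.assoc]) (by rw [this.2, Category.assoc])⟩)
  refine ⟨e, he, fun v => ?_⟩
  obtain ⟨y, hy, hy'⟩ := hU v
  exact ⟨y, by rw [LinearEquiv.symm_apply_eq]; exact hy.symm.trans (he y).symm, hy'⟩

/-- Coordinates on the spaces of stable morphisms from `T` to the middle terms of triangles which
depend piecewise rationally on the third morphism. -/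
theorem exists_families_middle (hfin : ∀ X Y : E, Module.Finite k (X ⟶ Y)) {V : Type*}
    [AddCommGroup V] [Module k V] {T L M : E} (σ : V →ₗ[k] (L ⟶ F.cosyz M)) :
    ∃ (N : ℕ) (c : ((T ⟶ F.hull M) × (T ⟶ L)) ≃ₗ[k] (Fin N → k)) (ι : Type) (_ : Finite ι)
      (r : ι → ℕ) (s : V → ι) (U : ∀ i, V → Matrix (Fin N) (Fin (r i)) k)
      (W : ∀ i, V → Matrix (Fin (r i)) (Fin N) k),
      IsPiecewiseConstant (affineSpaceRing k V) s ∧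
      (∀ i, IsRationalFamily (affineSpaceRing k V) (U i)) ∧
      (∀ i, IsRationalFamily (affineSpaceRing k V) (W i)) ∧
      ∀ ε (Y : E) (h : Y ⟶ F.hull M) (p : Y ⟶ L), IsPullback h p (F.hullπ M) (σ ε) →
        ∃ e : (F.proj.obj T ⟶ F.proj.obj Y) ≃ₗ[k] (Fin (r (s ε)) → k),
          (∀ y : T ⟶ Y, e (F.proj.map y) = W (s ε) ε *ᵥ c (y ≫ h, y ≫ p)) ∧
          ∀ v, ∃ y : T ⟶ Y, e.symm v = F.proj.map y ∧ c (y ≫ h, y ≫ p) = U (s ε) ε *ᵥ v := by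
  let b := Module.finBasis k ((T ⟶ F.hull M) × (T ⟶ L))
  let b₁ := Module.finBasis k ((F.hull T ⟶ F.hull M) × (F.hull T ⟶ L))
  let b' := Module.finBasis k (T ⟶ F.cosyz M)
  let b₁' := Module.finBasis k (F.hull T ⟶ F.cosyz M)
  have key : ∀ ε w, LinearMap.toMatrix b b' (pairMap k F M L T (σ ε)) *ᵥ b.equivFun w = 0 ↔
      pairMap k F M L T (σ ε) w = 0 := fun ε w => by
    rw [Module.Basis.equivFun_apply, LinearMap.toMatrix_mulVec_repr, ← Module.Basis.equivFun_apply,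
      map_eq_zero_iff _ b'.equivFun.injective]
  have key₁ : ∀ ε w, LinearMap.toMatrix b₁ b₁' (pairMap k F M L (F.hull T) (σ ε)) *ᵥ
      b₁.equivFun w = 0 ↔ pairMap k F M L (F.hull T) (σ ε) w = 0 := fun ε w => by
    rw [Module.Basis.equivFun_apply, LinearMap.toMatrix_mulVec_repr, ← Module.Basis.equivFun_apply,
      map_eq_zero_iff _ b₁'.equivFun.injective]
  have keyD : ∀ w, LinearMap.toMatrix b₁ b (pairPrecomp k F M L (F.hullι T)) *ᵥ b₁.equivFun w =
      b.equivFun (pairPrecomp k F M L (F.hullι T) w) := fun w => by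
    rw [Module.Basis.equivFun_apply, LinearMap.toMatrix_mulVec_repr, ← Module.Basis.equivFun_apply]
  obtain ⟨ι, hι, r, s, U, W, hs, hU, hW, h⟩ :=
    (isRationalFamily_pairMap σ b b').exists_basis_subquotient (isRationalFamily_pairMap σ b₁ b₁')
    (LinearMap.toMatrix b₁ b (pairPrecomp k F M L (F.hullι T))) (fun ε v hv => by
      obtain ⟨w, rfl⟩ := b₁.equivFun.surjective v
      rw [key₁] at hv
      rw [keyD, key]
      rw [pairMap_apply] at hv ⊢
      rw [pairPrecomp_apply, Category.assoc, Category.assoc, ← Preadditive.comp_sub, hv,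
        comp_zero])
  refine ⟨_, b.equivFun, ι, hι, r, s, U, W, hs, hU, hW, fun ε Y f p hpb => ?_⟩
  obtain ⟨h₁, h₂, h₃, h₄⟩ := h ε
  refine exists_linearEquiv_middle b.equivFun hpb (U (s ε) ε) (W (s ε) ε) (fun v => ?_) h₂
    (fun w hw => ?_) (fun w hw => ?_)
  · rw [← key, LinearEquiv.apply_symm_apply, mulVec_mulVec, h₁, zero_mulVec]
  · rw [← keyD]
    exact h₃ _ ((key₁ ε w).2 hw)
  · obtain ⟨v, hv, hw'⟩ := h₄ _ ((key ε w).2 hw)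
    obtain ⟨w', rfl⟩ := b₁.equivFun.surjective v
    exact ⟨w', (key₁ ε w').1 hv, by rw [← keyD]; exact hw'⟩

/-! ### Constructible lifts -/

/-- Bases at the vertices 1, 3 and 4 are fixed, so only the entries involving vertex 2, and the last
arrow, vary with `ε`. The former are products of `U`, `W` and constant matrices; the latter is
linear in `ε`. -/
theorem hasConstructibleLift_proj (hfin : ∀ X Y : E, Module.Finite k (X ⟶ Y)) (T L M : E) :
    F.HasConstructibleLift k (F.proj.obj T) (F.proj.obj L) (F.proj.obj M)
      {d | d .v1 = Module.finrank k (F.proj.obj T ⟶ F.proj.obj M) ∧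
        d .v3 = Module.finrank k (F.proj.obj T ⟶ F.proj.obj L) ∧ d .v2 ≤ d .v1 + d .v3 ∧
        d .v4 = Module.finrank k (F.proj.obj T ⟶ F.susp.obj (F.proj.obj M))} := by
  have hfin' : ∀ X Y : F.Stable, Module.Finite k (X ⟶ Y) := finite_stable_hom hfin
  have hfinEnd : Module.Finite k (End (F.proj.obj T)) := hfin' (F.proj.obj T) (F.proj.obj T)
  -- The representative in `E` is chosen linearly, so that the matrices of `pairMap` remain affine
  -- in `ε`.
  obtain ⟨σ, hσ⟩ := (F.connectingₗ k L M).exists_rightInverse_of_surjective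
    (LinearMap.range_eq_top.2 (connectingₗ_surjective L M))
  replace hσ : ∀ ε, connecting (σ ε) = ε := fun ε => LinearMap.congr_fun hσ ε
  choose Y h p i hpb hih hip htri using fun ε => exists_isTriangle_pullback (σ ε)
  replace htri : ∀ ε, F.IsTriangle (M := F.proj.obj M) (F.proj.map (i ε)) (F.proj.map (p ε)) ε :=
    fun ε => by simpa only [hσ] using htri ε
  obtain ⟨N, c, ι, hι, r, s, U, W, hs, hU, hW, he⟩ := exists_families_middle hfin (T := T) σ
  choose e₂ he₂ he₂' using fun ε => he ε (Y ε) (h ε) (p ε) (hpb ε)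
  let e₁ := (Module.finBasis k (F.proj.obj T ⟶ F.proj.obj M)).equivFun
  let e₃ := (Module.finBasis k (F.proj.obj T ⟶ F.proj.obj L)).equivFun
  let e₄ := (Module.finBasis k (F.proj.obj T ⟶ F.susp.obj (F.proj.obj M))).equivFun
  let d : ι → QuiverA4 → ℕ := fun j => QuiverA4.dimVec
    (Module.finrank k (F.proj.obj T ⟶ F.proj.obj M)) (r j)
    (Module.finrank k (F.proj.obj T ⟶ F.proj.obj L))
    (Module.finrank k (F.proj.obj T ⟶ F.susp.obj (F.proj.obj M)))
  have hr : ∀ ε, Module.finrank k (F.proj.obj T ⟶ F.proj.obj (Y ε)) = r (s ε) := fun ε => by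
    rw [(e₂ ε).finrank_eq, Module.finrank_fin_fun]
  have hd : ∀ ε, d (s ε) .v2 ≤ d (s ε) .v1 + d (s ε) .v3 := fun ε => by
    change r (s ε) ≤ _
    rw [← hr]
    exact (htri ε).finrank_le _
  let e : ∀ ε q, (F.proj.obj T ⟶
      (QuiverA4.diagram (F.proj.map (i ε)) (F.proj.map (p ε)) ε).obj q) ≃ₗ[k]
        (Fin (d (s ε) q) → k) := fun ε q =>
    match q with
    | .v1 => e₁
    | .v2 => e₂ ε
    | .v3 => e₃
    | .v4 => e₄
  choose ρ hρ hact hmap using fun ε => exists_matRep_of_linearEquiv (F.proj.obj T)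
    (QuiverA4.diagram (F.proj.map (i ε)) (F.proj.map (p ε)) ε) (d (s ε)) (e ε)
  have hcol : ∀ {m n : ℕ} (A : Matrix (Fin m) (Fin n) k) (a a'),
      (A *ᵥ Pi.single a' 1) a = A a a' := fun A a a' => by rw [mulVec_single_one]; rfl
  -- `B b` and `J` are matrices on the ambient space of pairs, independent of `ε`: precomposition
  -- with `b`, and the second component read in the stable category.
  let B : (T ⟶ T) → Matrix (Fin N) (Fin N) k := fun b => LinearMap.toMatrix'
    (c.toLinearMap ∘ₗ pairPrecomp k F M L b ∘ₗ c.symm.toLinearMap)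
  let J := LinearMap.toMatrix' (e₃.toLinearMap ∘ₗ F.proj.mapLinearMap k ∘ₗ
    LinearMap.snd k (T ⟶ F.hull M) (T ⟶ L) ∘ₗ c.symm.toLinearMap)
  have hact₂ : ∀ ε (b : T ⟶ T) v, e₂ ε (F.proj.map b ≫ (e₂ ε).symm v) =
      (W (s ε) ε * B b * U (s ε) ε) *ᵥ v := fun ε b v => by
    obtain ⟨y, hy, hy'⟩ := he₂' ε v
    rw [hy, ← Functor.map_comp, he₂, ← mulVec_mulVec, ← hy', ← mulVec_mulVec,
      LinearMap.toMatrix'_mulVec]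
    simp [pairPrecomp_apply]
  have hmap₁ : ∀ ε (x : T ⟶ M), e₂ ε (F.proj.map x ≫ F.proj.map (i ε)) =
      W (s ε) ε *ᵥ c (x ≫ F.hullι M, 0) := fun ε x => by
    rw [← Functor.map_comp, he₂, Category.assoc, Category.assoc, hih, hip, comp_zero]
  have hmap₂ : ∀ ε v, e₃ ((e₂ ε).symm v ≫ F.proj.map (p ε)) =
      (J * U (s ε) ε) *ᵥ v := fun ε v => by
    obtain ⟨y, hy, hy'⟩ := he₂' ε v
    rw [hy, ← Functor.map_comp, ← mulVec_mulVec, ← hy', LinearMap.toMatrix'_mulVec]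
    simp [Functor.coe_mapLinearMap]
  refine ⟨fun ε => ⟨⟨d (s ε), rfl, rfl, hd ε, rfl⟩, ρ ε⟩, ?_, fun ε =>
    ⟨⟨_, _, _, htri ε⟩, fun Y' i' p' h' => (htri ε).homOrbit_subset h' _ _ (hρ ε)⟩⟩
  refine isConstructibleMap_sigma
    (G₀ := fun d : Subtype _ => MatRep.entries k (End (F.proj.obj T)) QuiverA4 d.1)
    (fun d => MatRep.exists_finite_entries k (End (F.proj.obj T)) QuiverA4 d.1) _ s hs (fun ε ε' hε => ?_) ?_
  · exact Subtype.ext (congrArg d hε)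
  · rintro j ⟨d', hd'⟩ g hg
    by_cases hj : d' = d j
    swap
    -- The stratum never meets this component, so any function will do.
    · refine ⟨0, .of_mem (Subalgebra.zero_mem _), fun ε y hε hφ => (hj ?_).elim⟩
      rw [← hε]
      exact (congrArg (fun x => x.1.1) hφ).symm
    subst hj
    rcases hg with ⟨q, b, a, a', rfl⟩ | ⟨q, q', α, a, a', rfl⟩
    · obtain ⟨b', hb'⟩ := F.proj.map_surjective (X := T) (Y := T) b.unop
      rcases q with _ | _ | _ | _
      · refine ⟨fun _ => e₁ ((show F.proj.obj T ⟶ F.proj.obj T from b.unop) ≫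
          e₁.symm (Pi.single a' 1)) a, (piecewiseRational _).algebraMap_mem _, ?_⟩
        rintro ε y rfl hφ
        cases hφ
        exact hact ε .v1 b a a'
      · refine ⟨_, (((hW j).mul (.const (B b'))).mul (hU j)) a a', ?_⟩
        rintro ε y rfl hφ
        cases hφ
        refine (hact ε .v2 b a a').trans ?_
        rw [← hb']
        refine (congrFun (hact₂ ε b' (Pi.single a' 1)) a).trans ?_
        exact hcol _ a a'
      · refine ⟨fun _ => e₃ ((show F.proj.obj T ⟶ F.proj.obj T from b.unop) ≫
          e₃.symm (Pi.single a' 1)) a, (piecewiseRational _).algebraMap_mem _, ?_⟩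
        rintro ε y rfl hφ
        cases hφ
        exact hact ε .v3 b a a'
      · refine ⟨fun _ => e₄ ((show F.proj.obj T ⟶ F.proj.obj T from b.unop) ≫
          e₄.symm (Pi.single a' 1)) a, (piecewiseRational _).algebraMap_mem _, ?_⟩
        rintro ε y rfl hφ
        cases hφ
        exact hact ε .v4 b a a'
    · rcases α with _ | _ | _
      · obtain ⟨x, hx⟩ := F.proj.map_surjective (X := T) (Y := M) (e₁.symm (Pi.single a' 1))
        refine ⟨_, ((hW j).mul (.const (Matrix.of fun b (_ : Unit) => c (x ≫ F.hullι M, 0) b)))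
          a (), ?_⟩
        rintro ε y rfl hφ
        cases hφ
        refine (hmap ε _ _ QuiverA4.Arrow.a12 a a').trans ?_
        refine (congrArg (fun z => e₂ ε (z ≫ F.proj.map (i ε)) a) hx.symm).trans ?_
        exact congrFun (hmap₁ ε x) a
      · refine ⟨_, ((IsRationalFamily.const J).mul (hU j)) a a', ?_⟩
        rintro ε y rfl hφ
        cases hφ
        refine (hmap ε _ _ QuiverA4.Arrow.a23 a a').trans ?_
        refine (congrFun (hmap₂ ε (Pi.single a' 1)) a).trans ?_
        exact hcol _ a a'
      · refine ⟨fun ε => e₄ (e₃.symm (Pi.single a' 1) ≫ ε) a, .of_mem (Algebra.subset_adjoin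
          ⟨LinearMap.proj a ∘ₗ e₄.toLinearMap ∘ₗ
            Linear.leftComp k _ (e₃.symm (Pi.single a' 1)), rfl⟩), ?_⟩
        rintro ε y rfl hφ
        cases hφ
        exact hmap ε _ _ QuiverA4.Arrow.a34 a a'

/-- The same pieces work, since regular functions on the larger disjoint union restrict to regular
functions on the smaller one. -/
theorem HasConstructibleLift.mono {T L M : F.Stable} {D D' : Set (QuiverA4 → ℕ)} (hD : D ⊆ D')
    (h : F.HasConstructibleLift k T L M D) : F.HasConstructibleLift k T L M D' := by
  obtain ⟨φ, ⟨n, S, hS, hdisj, hcov, hφ⟩, h⟩ := h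
  let f : (Σ d : D, MatRep k (End T) QuiverA4 d.1) → Σ d : D', MatRep k (End T) QuiverA4 d.1 :=
    fun x => ⟨⟨x.1.1, hD x.1.2⟩, x.2⟩
  exact ⟨fun ε => f (φ ε), ⟨n, S, hS, hdisj, hcov, fun j g hg =>
    hφ j (g ∘ f) fun d => hg ⟨d.1, hD d.2⟩⟩, h⟩

end FrobeniusStructure

end

theorem mainTheorem3 {k : Type*} [Field k] [IsAlgClosed k]
    {E : Type u} [Category.{v} E] [Preadditive E] [Linear k E] [HasFiniteBiproducts E]
    (hfin : ∀ X Y : E, Module.Finite k (X ⟶ Y)) (hKS : IsKrullSchmidt E)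
    (F : FrobeniusStructure E) :
    F.HasConstructibleCones k ∧
    (∀ T L M : F.Stable, F.HasConstructibleLift k T L M
      {d | d .v1 = Module.finrank k (T ⟶ M) ∧ d .v3 = Module.finrank k (T ⟶ L) ∧
        d .v2 ≤ d .v1 + d .v3 ∧ d .v4 = Module.finrank k (T ⟶ F.susp.obj M)}) ∧
    ∀ (T M Y L : F.Stable) (i : M ⟶ Y) (p : Y ⟶ L) (ε : L ⟶ F.susp.obj M), F.IsTriangle i p ε →
      Function.Exact (fun x : T ⟶ M => x ≫ i) (fun x : T ⟶ Y => x ≫ p) ∧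
      Function.Exact (fun x : T ⟶ Y => x ≫ p) (fun x : T ⟶ L => x ≫ ε) := by
  have h : ∀ T L M : F.Stable, F.HasConstructibleLift k T L M
      {d | d .v1 = Module.finrank k (T ⟶ M) ∧ d .v3 = Module.finrank k (T ⟶ L) ∧
        d .v2 ≤ d .v1 + d .v3 ∧ d .v4 = Module.finrank k (T ⟶ F.susp.obj M)} :=
    -- Every object of the stable category is definitionally the image of its underlying object in
    -- `E`.
    fun T L M => FrobeniusStructure.hasConstructibleLift_proj hfin T.as L.as M.as
  refine ⟨fun T L M => (h T L M).mono ?_, h, fun T M Y L i p ε ht => ⟨ht.exact₂ T, ht.exact₃ T⟩⟩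
  rintro d ⟨h1, h3, h2, h4⟩ (_ | _ | _ | _)
  exacts [h1.le, h2.trans_eq (congrArg₂ (· + ·) h1 h3), h3.le, h4.le]
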